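/- Let $M_k$ be the algebra of complex $k\times k$ matrices, identify $M_k\otimes M_k$ with $M_{k^2}$ through the Kronecker product, and use the trace inner product $\langle X,Y\rangle=\operatorname{tr}(XY^*)$ on $M_k$. Let $A=\sum_{i=1}^n A_i\otimes B_i\in M_k\otimes M_k$ be PPT, that is, $A$ and its partial transpose $\sum_i A_i\otimes B_i^t$ are both positive semidefinite Hermitian. Let $T:M_k\to M_k$ be the linear map $T(X)=\sum_{i=1}^n \operatorname{tr}(A_iX^t)B_i$, and let $T^*$ be its adjoint for the trace inner product. Suppose that $\operatorname{Im}(T(X))\supseteq\operatorname{Im}(X)$ for every positive semidefinite $X\in M_k$. Terminology. A linear map $L:M_k\to M_k$ is doubly stochastic if it maps positive semidefinite matrices to positive semidefinite matrices, $L(\mathrm{Id})=\mathrm{Id}$ and $L^*(\mathrm{Id})=\mathrm{Id}$; $T$ is equivalent to $L$ if there are invertible $R,S\in M_k$ with $L(X)=S\,T(RXR^*)\,S^*$ for all $X$. For an orthogonal projection $V\in M_k$ put $VM_kV=\{VXV: X\in M_k\}$. A linear map $L:VM_kV\to VM_kV$ is irreducible if it is nonzero, maps positive semidefinite matrices to positive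 semidefinite matrices, and the only orthogonal projections $V'$ with $V'M_kV'\subseteq VM_kV$ and $L(V'M_kV')\subseteq V'M_kV'$ are $V'=V$ and $V'=0$. The spectral radius of $L$ is the largest absolute value of an eigenvalue of $L$. Then the following three statements are equivalent: (1) $T$ is equivalent to a doubly stochastic map. (2) There are orthogonal projections $V_1,\dots,V_s\in M_k$ such that $\mathbb{C}^k=\bigoplus_{i=1}^s\operatorname{Im}(V_i)$ (a direct sum, not necessarily orthogonal) and, for every $i$, $T(V_iM_kV_i)\subseteq V_iM_kV_i$ and $T|_{V_iM_kV_i}$ is irreducible. (3) For every orthogonal projection $V\in M_k$ such that $T(VM_kV)\subseteq VM_kV$ and $T|_{VM_kV}$ is irreducible with spectral radius $\lambda$, there is a unique orthogonal projection $W\in M_k$ such that $T^*(WM_kW)\subseteq WM_kW$, $T^*|_{WM_kW}$ is irreducible with spectral radius $\lambda$, $\operatorname{rank}(W)=\operatorname{rank}(V)$ and $\ker(W)\cap\operatorname{Im}(V)=\{0\}$. -/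

import Mathlib

open scoped Kronecker ComplexOrder

noncomputable section

/-- Complex square matrices of order `k`. -/
abbrev Mat (k : ℕ) : Type := Matrix (Fin k) (Fin k) ℂ

/-- `M_k ⊗ M_m`, identified with `M_{km}` through the Kronecker product. -/
abbrev BiMat (k m : ℕ) : Type := Matrix (Fin k × Fin m) (Fin k × Fin m) ℂ

/-- The image of a matrix acting on column vectors. -/
abbrev matIm {k : ℕ} (X : Mat k) : Submodule ℂ (Fin k → ℂ) := LinearMap.range X.mulVecLin

/-- The kernel of a matrix acting on column vectors. -/
abbrev matKer {k : ℕ} (X : Mat k) : Submodule ℂ (Fin k → ℂ) := LinearMap.ker X.mulVecLin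

/-- The partial transposition on the second factor. -/
def partialTranspose {k m : ℕ} (A : BiMat k m) : BiMat k m :=
  Matrix.of fun p q => A (p.1, q.2) (q.1, p.2)

/-- `partialTranspose` is the map `∑ Aᵢ ⊗ Bᵢ ↦ ∑ Aᵢ ⊗ Bᵢᵗ`. -/
theorem partialTranspose_sum_kronecker {k m n : ℕ} (A : Fin n → Mat k) (B : Fin n → Mat m) :
    partialTranspose (∑ i, A i ⊗ₖ B i) = ∑ i, A i ⊗ₖ (B i).transpose := by
  ext ⟨a, b⟩ ⟨c, d⟩
  simp [partialTranspose, Matrix.sum_apply, Matrix.kroneckerMap_apply]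

/-- `A` is positive under partial transposition: `A` and its partial transpose are positive
semidefinite Hermitian. -/
def IsPPT {k m : ℕ} (A : BiMat k m) : Prop :=
  A.PosSemidef ∧ (partialTranspose A).PosSemidef

/-- The linear map `G_A : M_k → M_m`, `G_A(X) = ∑ tr(Aᵢ X) Bᵢ` for `A = ∑ Aᵢ ⊗ Bᵢ`, written in
coordinates (see `mapG_sum_kronecker`). -/
def mapG {k m : ℕ} (A : BiMat k m) : Mat k →ₗ[ℂ] Mat m where
  toFun X := Matrix.of fun b d => ∑ a, ∑ c, A (a, b) (c, d) * X c a
  map_add' X Y := by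
    ext b d
    simp [mul_add, Finset.sum_add_distrib]
  map_smul' r X := by
    ext b d
    simp [Finset.mul_sum, mul_left_comm]

theorem mapG_sum_kronecker {k m n : ℕ} (A : Fin n → Mat k) (B : Fin n → Mat m) (X : Mat k) :
    mapG (∑ i, A i ⊗ₖ B i) X = ∑ i, (A i * X).trace • B i := by
  ext b d
  simp only [mapG, LinearMap.coe_mk, AddHom.coe_mk, Matrix.of_apply, Matrix.sum_apply,
    Matrix.kroneckerMap_apply, Matrix.smul_apply, smul_eq_mul, Matrix.trace, Matrix.diag,
    Matrix.mul_apply, Finset.sum_mul]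
  rw [Finset.sum_comm' (t' := Finset.univ) (s' := fun _ => Finset.univ) (by simp),
    Finset.sum_comm]
  simp only [Finset.sum_comm (s := Finset.univ (α := Fin n))]
  refine Finset.sum_congr rfl fun a _ => Finset.sum_congr rfl fun c _ =>
    Finset.sum_congr rfl fun i _ => ?_
  ring

/-- The map `X ↦ G_A(Xᵗ)`. -/
def mapGT {k m : ℕ} (A : BiMat k m) : Mat k →ₗ[ℂ] Mat m :=
  mapG A ∘ₗ (Matrix.transposeLinearEquiv (Fin k) (Fin k) ℂ ℂ).toLinearMap

theorem mapGT_apply {k m : ℕ} (A : BiMat k m) (X : Mat k) :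
    mapGT A X = mapG A X.transpose := rfl

/-- The adjoint of `T : M_k → M_k` for the trace inner product `⟨X, Y⟩ = tr(X Yᴴ)`, given by its
coordinates `T*(Y)ᵢⱼ = ⟨Y, T(Eᵢⱼ)⟩` (see `trace_mul_traceAdjoint`). -/
def traceAdjoint {k : ℕ} (T : Mat k →ₗ[ℂ] Mat k) : Mat k →ₗ[ℂ] Mat k where
  toFun Y := Matrix.of fun i j => (Y * (T (Matrix.single i j 1)).conjTranspose).trace
  map_add' Y Z := by
    ext i j
    simp [add_mul]
  map_smul' r Y := by
    ext i j
    simp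

/-- `⟨T X, Y⟩ = ⟨X, T* Y⟩`. -/
theorem trace_mul_traceAdjoint {k : ℕ} (T : Mat k →ₗ[ℂ] Mat k) (X Y : Mat k) :
    (T X * Y.conjTranspose).trace = (X * (traceAdjoint T Y).conjTranspose).trace := by
  have key : ∀ i j, star ((traceAdjoint T Y) i j) =
      (T (Matrix.single i j 1) * Y.conjTranspose).trace := by
    intro i j
    simp only [traceAdjoint, LinearMap.coe_mk, AddHom.coe_mk, Matrix.of_apply]
    rw [← Matrix.trace_conjTranspose, Matrix.conjTranspose_mul, Matrix.conjTranspose_conjTranspose]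
  have hX : X = ∑ i, ∑ j, X i j • Matrix.single i j (1 : ℂ) := by
    conv_lhs => rw [Matrix.matrix_eq_sum_single X]
    simp [Matrix.smul_single]
  conv_lhs => rw [hX]
  simp only [map_sum, map_smul, Finset.sum_mul, Matrix.trace_sum, Matrix.smul_mul,
    Matrix.trace_smul, ← key]
  simp [Matrix.trace, Matrix.mul_apply]

/-- `T : M_k → M_k` sends positive semidefinite matrices to positive semidefinite matrices. -/
def IsPositiveMap {k : ℕ} (T : Mat k →ₗ[ℂ] Mat k) : Prop :=
  ∀ X : Mat k, X.PosSemidef → (T X).PosSemidef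

/-- Doubly stochastic maps `M_k → M_k`. -/
def IsDoublyStochastic {k : ℕ} (T : Mat k →ₗ[ℂ] Mat k) : Prop :=
  IsPositiveMap T ∧ T 1 = 1 ∧ traceAdjoint T 1 = 1

/-- Equivalence of maps: `L₂(X) = S L₁(R X Rᴴ) Sᴴ` with `R`, `S` invertible. -/
def MapEquivalent {k : ℕ} (L₁ L₂ : Mat k →ₗ[ℂ] Mat k) : Prop :=
  ∃ R S : Mat k, IsUnit R ∧ IsUnit S ∧
    ∀ X, L₂ X = S * L₁ (R * X * R.conjTranspose) * S.conjTranspose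

/-- The corner `V M_k V = {V X V : X ∈ M_k}`. -/
def corner {k : ℕ} (V : Mat k) : Submodule ℂ (Mat k) where
  carrier := {Y | ∃ X : Mat k, Y = V * X * V}
  add_mem' := by
    rintro _ _ ⟨X, rfl⟩ ⟨Y, rfl⟩
    exact ⟨X + Y, by rw [mul_add, add_mul]⟩
  zero_mem' := ⟨0, by simp⟩
  smul_mem' := by
    rintro r _ ⟨X, rfl⟩
    exact ⟨r • X, by simp⟩

/-- `T(V M_k V) ⊆ V M_k V`. -/
def LeavesCornerInvariant {k : ℕ} (T : Mat k →ₗ[ℂ] Mat k) (V : Mat k) : Prop :=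
  ∀ X ∈ corner V, T X ∈ corner V

/-- A linear map `L : V M_k V → V M_k V` is irreducible: it is a nonzero positive map, and the only
orthogonal projections `V'` whose corner `V' M_k V'` is a subset of `V M_k V` and is left invariant
by `L` are `V` and `0`. -/
def IsIrreducibleMap {k : ℕ} (V : Mat k) (L : corner V →ₗ[ℂ] corner V) : Prop :=
  (∀ X : corner V, (X : Mat k).PosSemidef → (L X : Mat k).PosSemidef) ∧
  L ≠ 0 ∧
  ∀ V' : Mat k, IsStarProjection V' → corner V' ≤ corner V →
    (∀ X : corner V, (X : Mat k) ∈ corner V' → (L X : Mat k) ∈ corner V') →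
    V = V' ∨ V' = 0

/-- `lam` is the spectral radius of `L`: the largest absolute value of an eigenvalue of `L`. -/
def IsSpectralRadius {k : ℕ} {V : Mat k} (L : corner V →ₗ[ℂ] corner V) (lam : ℝ) : Prop :=
  IsGreatest {r : ℝ | ∃ μ : ℂ, Module.End.HasEigenvalue L μ ∧ r = ‖μ‖} lam

/-- `T(V M_k V) ⊆ V M_k V` and the restriction of `T` to `V M_k V` is irreducible. -/
def IsIrreducibleOn {k : ℕ} (T : Mat k →ₗ[ℂ] Mat k) (V : Mat k) : Prop :=
  ∃ h : LeavesCornerInvariant T V, IsIrreducibleMap V (T.restrict h)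

/-- `T(V M_k V) ⊆ V M_k V` and the restriction of `T` to `V M_k V` is irreducible with spectral
radius `lam`. -/
def IsIrreducibleOnWithRadius {k : ℕ} (T : Mat k →ₗ[ℂ] Mat k) (V : Mat k) (lam : ℝ) : Prop :=
  ∃ h : LeavesCornerInvariant T V,
    IsIrreducibleMap V (T.restrict h) ∧ IsSpectralRadius (T.restrict h) lam

end

/-! The argument works with subspaces `U` of ℂ^k preserved by `T`: positive semidefinite matrices
with image in `U` go to matrices with image in `U`. Invariance of a corner is preservation of the
image of its projection. Because `Im (T X) ⊇ Im X`, irreducibility on a corner is minimality among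
the nonzero preserved subspaces (`isIrreducibleOn_iff_isMinimalPreserved`). Passing to the adjoint
replaces a preserved subspace by its orthogonal complement.

Statement (2) holds as soon as every minimal preserved subspace has a preserved complement
(`exists_decomposition`). Under (1), a doubly stochastic map carrying a projection into a corner of
the same rank must carry it onto the projection of that corner, hence carries the complementary
projection to the complementary one (`exists_isCompl_of_mapEquivalent`). Under (3), the complement
is `ker W`.

Leaving (2) uses PPT: it forces `T` to vanish between different summands, so `T` is block diagonal
for the idempotents `p i` of the direct sum (`exists_isBlockSystem`). By the support condition every
preserved subspace is stable under the `p i`, so the summands are the only minimal ones and `W` in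
(3) must have the kernel of `p i`. The trace pairing of the two corners is then nondegenerate, which
equates the spectral radii (`existsUnique_of_isBlockSystem`).

For (2) ⇒ (1), it suffices to find positive definite `X` with `tr (T H (T X)⁻¹) = tr (H X⁻¹)` for
all `H`; conjugating by the square roots of `X` and `T X` then gives a doubly stochastic map. This
is the critical point equation of `det X / det (T X)` on block diagonal matrices with blocks of
trace one. As `T X` may be singular on the boundary, `T` is perturbed to `T + ε D`, maximizers are
taken, and ε tends to 0. A rank comparison together with minimality of the blocks shows that the
limit is positive definite (`IsBlockSystem.exists_fixedPoint`). -/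

noncomputable section

/-! ### Images, projections, corners and the order on positive semidefinite matrices. -/

namespace Mat

open scoped MatrixOrder Matrix.Norms.L2Operator

variable {k : ℕ}

theorem matIm_mul_le (X Y : Mat k) : matIm (X * Y) ≤ matIm X := by
  rintro _ ⟨v, rfl⟩
  exact ⟨Y.mulVec v, by simp⟩

theorem matIm_le_iff_mul_eq {V X : Mat k} (hV : IsIdempotentElem V) :
    matIm X ≤ matIm V ↔ V * X = X := by
  constructor
  · intro h
    refine Matrix.ext_of_mulVec_single fun i => ?_
    obtain ⟨v, hv⟩ := h ⟨Pi.single i 1, rfl⟩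
    simp only [Matrix.mulVecLin_apply] at hv
    rw [← Matrix.mulVec_mulVec, ← hv, Matrix.mulVec_mulVec, hV]
  · intro h
    rw [← h]
    exact matIm_mul_le V X

theorem mem_matIm_iff {V : Mat k} (hV : IsIdempotentElem V) {x : Fin k → ℂ} :
    x ∈ matIm V ↔ V.mulVec x = x := by
  constructor
  · rintro ⟨v, rfl⟩
    simp [Matrix.mulVec_mulVec, hV.eq]
  · intro h
    exact ⟨x, h⟩

theorem exists_starProjection (U : Submodule ℂ (Fin k → ℂ)) :
    ∃ V : Mat k, IsStarProjection V ∧ matIm V = U := by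
  let e := WithLp.linearEquiv 2 ℂ (Fin k → ℂ)
  let U' : Submodule ℂ (EuclideanSpace ℂ (Fin k)) := U.map e.symm.toLinearMap
  let f : EuclideanSpace ℂ (Fin k) →L[ℂ] EuclideanSpace ℂ (Fin k) := U'.starProjection
  have hf : IsStarProjection f := isStarProjection_starProjection
  obtain ⟨P, hP⟩ : ∃ P, Matrix.toEuclideanCLM (n := Fin k) (𝕜 := ℂ) P = f :=
    EquivLike.surjective (Matrix.toEuclideanCLM (n := Fin k) (𝕜 := ℂ)) f
  have hV : ∀ x : Fin k → ℂ, P.mulVec x = (f (WithLp.toLp 2 x)).ofLp := by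
    intro x
    rw [← hP]
    simp
  refine ⟨P, ⟨?_, ?_⟩, ?_⟩
  · apply EquivLike.injective (Matrix.toEuclideanCLM (n := Fin k) (𝕜 := ℂ))
    rw [map_mul, hP, hf.isIdempotentElem.eq]
  · apply EquivLike.injective (Matrix.toEuclideanCLM (n := Fin k) (𝕜 := ℂ))
    rw [map_star, hP, hf.isSelfAdjoint.star_eq]
  · ext x
    constructor
    · rintro ⟨v, rfl⟩
      rw [Matrix.mulVecLin_apply, hV]
      obtain ⟨u, hu, hu'⟩ := Submodule.starProjection_apply_mem U' (WithLp.toLp 2 v)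
      change (U'.starProjection (WithLp.toLp 2 v)).ofLp ∈ U
      rw [← hu']
      exact hu
    · intro hx
      refine ⟨x, ?_⟩
      rw [Matrix.mulVecLin_apply, hV]
      have : f (WithLp.toLp 2 x) = WithLp.toLp 2 x :=
        Submodule.starProjection_eq_self_iff.2 ⟨x, hx, rfl⟩
      rw [this]

theorem starProjection_conjTranspose {V : Mat k} (hV : IsStarProjection V) : V.conjTranspose = V :=
  hV.isSelfAdjoint

theorem starProjection_ext {V W : Mat k} (hV : IsStarProjection V) (hW : IsStarProjection W)
    (h : matIm V = matIm W) : V = W := by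
  have h₁ := (matIm_le_iff_mul_eq hW.isIdempotentElem).1 h.le
  have h₂ := (matIm_le_iff_mul_eq hV.isIdempotentElem).1 h.ge
  have h₃ := congrArg Matrix.conjTranspose h₂
  rw [Matrix.conjTranspose_mul, starProjection_conjTranspose hV,
    starProjection_conjTranspose hW] at h₃
  rw [← h₁, h₃]

theorem posSemidef_of_starProjection {V : Mat k} (hV : IsStarProjection V) : V.PosSemidef :=
  Matrix.nonneg_iff_posSemidef.1 hV.nonneg

theorem matKer_eq_matIm_one_sub {V : Mat k} (hV : IsIdempotentElem V) :
    matKer V = matIm (1 - V) := by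
  ext x
  rw [mem_matIm_iff hV.one_sub]
  simp [Matrix.sub_mulVec]

theorem mul_eq_zero_of_mul_mul_conjTranspose {Q B : Mat k}
    (h : Q * (B * B.conjTranspose) * Q.conjTranspose = 0) : Q * B = 0 := by
  rw [← Matrix.trace_mul_conjTranspose_self_eq_zero_iff, Matrix.conjTranspose_mul]
  simp only [Matrix.mul_assoc] at h ⊢
  rw [h, Matrix.trace_zero]

theorem matIm_self_mul_conjTranspose (X : Mat k) : matIm (X * X.conjTranspose) = matIm X := by
  refine le_antisymm (matIm_mul_le _ _) ?_
  obtain ⟨V, hV, h⟩ := exists_starProjection (matIm (X * X.conjTranspose))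
  rw [← h, matIm_le_iff_mul_eq hV.isIdempotentElem]
  have h₁ := (matIm_le_iff_mul_eq hV.isIdempotentElem).1 h.ge
  have h₂ : (1 - V) * X = 0 := by
    apply mul_eq_zero_of_mul_mul_conjTranspose
    rw [sub_mul, h₁, one_mul, sub_self, zero_mul]
  rw [sub_mul, one_mul, sub_eq_zero] at h₂
  exact h₂.symm

theorem exists_posSemidef_sqrt {X : Mat k} (hX : X.PosSemidef) :
    ∃ R : Mat k, R.PosSemidef ∧ R * R = X :=
  ⟨CFC.sqrt X, Matrix.nonneg_iff_posSemidef.1 (CFC.sqrt_nonneg X),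
    CFC.sqrt_mul_sqrt_self X (Matrix.nonneg_iff_posSemidef.2 hX)⟩

theorem matIm_mul_self {R : Mat k} (hR : R.PosSemidef) : matIm (R * R) = matIm R := by
  have := matIm_self_mul_conjTranspose R
  rwa [hR.isHermitian.eq] at this

theorem mul_eq_zero_of_conj {Q X : Mat k} (hX : X.PosSemidef)
    (h : Q * X * Q.conjTranspose = 0) : Q * X = 0 := by
  obtain ⟨R, hR, rfl⟩ := exists_posSemidef_sqrt hX
  have : Q * R = 0 := mul_eq_zero_of_mul_mul_conjTranspose (by rwa [hR.isHermitian.eq])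
  rw [← mul_assoc, this, zero_mul]

theorem trace_mul_nonneg {X Y : Mat k} (hX : X.PosSemidef) (hY : Y.PosSemidef) :
    0 ≤ (X * Y).trace := by
  obtain ⟨R, hR, rfl⟩ := exists_posSemidef_sqrt hX
  rw [mul_assoc, Matrix.trace_mul_comm]
  have := (hY.mul_mul_conjTranspose_same R).trace_nonneg
  rwa [hR.isHermitian.eq] at this

theorem mul_eq_zero_of_trace {X Y : Mat k} (hX : X.PosSemidef) (hY : Y.PosSemidef)
    (h : (X * Y).trace = 0) : X * Y = 0 := by
  obtain ⟨R, hR, rfl⟩ := exists_posSemidef_sqrt hX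
  rw [mul_assoc, Matrix.trace_mul_comm] at h
  have h₁ := hY.mul_mul_conjTranspose_same R
  rw [hR.isHermitian.eq] at h₁
  have h₂ := mul_eq_zero_of_conj (Q := R) hY (by rw [hR.isHermitian.eq, h₁.trace_eq_zero_iff.1 h])
  rw [mul_assoc, h₂, mul_zero]

theorem eq_of_posSemidef_sub_of_trace {X Y : Mat k} (h : (Y - X).PosSemidef)
    (ht : X.trace = Y.trace) : X = Y := by
  have := h.trace_eq_zero_iff.1 (by rw [Matrix.trace_sub, ht, sub_self])
  exact (sub_eq_zero.1 this).symm

theorem trace_starProjection {V : Mat k} (hV : IsIdempotentElem V) :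
    V.trace = Module.finrank ℂ (matIm V) := by
  have h : LinearMap.IsProj (matIm V) V.mulVecLin :=
    ⟨fun x => ⟨x, rfl⟩, fun x hx => (mem_matIm_iff hV).1 hx⟩
  rw [← h.trace]
  simp [LinearMap.trace_eq_matrix_trace ℂ (Pi.basisFun ℂ (Fin k)), LinearMap.toMatrix_eq_toMatrix',
    ← Matrix.toLin'_apply']

theorem exists_smul_one_sub (H : Mat k) (hH : H.IsHermitian) :
    ∃ c : ℝ, 0 ≤ c ∧ ((c : ℂ) • (1 : Mat k) - H).PosSemidef ∧
      ((c : ℂ) • (1 : Mat k) + H).PosSemidef := by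
  have h₁ : IsSelfAdjoint H := hH
  have e : algebraMap ℝ (Mat k) ‖H‖ = ((‖H‖ : ℝ) : ℂ) • (1 : Mat k) := by
    rw [Algebra.algebraMap_eq_smul_one]
    ext i j
    simp
  refine ⟨‖H‖, norm_nonneg H, ?_, ?_⟩
  · have := h₁.le_algebraMap_norm_self
    rwa [e, Matrix.le_iff] at this
  · have := h₁.neg_algebraMap_norm_le_self
    rw [e, Matrix.le_iff] at this
    rwa [sub_neg_eq_add, add_comm] at this

theorem exists_mul_eq_of_matIm_le {X Y : Mat k} (h : matIm X ≤ matIm Y) :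
    ∃ C : Mat k, X = Y * C := by
  have : ∀ i, ∃ c, Y.mulVec c = X.mulVec (Pi.single i 1) := fun i => h ⟨Pi.single i 1, rfl⟩
  choose c hc using this
  refine ⟨(Matrix.of c).transpose, Matrix.ext_of_mulVec_single fun i => ?_⟩
  rw [← hc, ← Matrix.mulVec_mulVec]
  congr 1
  ext j
  simp

/-- With square roots `R` of `X` and `S` of `Y`, the inclusion of images gives `R = S C`, hence `X =
S (C Cᴴ) S ≤ c S²` where `c` bounds `C Cᴴ`. -/
theorem exists_smul_sub_posSemidef {X Y : Mat k} (hX : X.PosSemidef) (hY : Y.PosSemidef)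
    (h : matIm X ≤ matIm Y) : ∃ c : ℝ, 0 ≤ c ∧ ((c : ℂ) • Y - X).PosSemidef := by
  obtain ⟨R, hR, rfl⟩ := exists_posSemidef_sqrt hX
  obtain ⟨S, hS, rfl⟩ := exists_posSemidef_sqrt hY
  rw [matIm_mul_self hR, matIm_mul_self hS] at h
  obtain ⟨C, rfl⟩ := exists_mul_eq_of_matIm_le h
  obtain ⟨c, hc, h₁, -⟩ := exists_smul_one_sub (C * C.conjTranspose)
    (Matrix.posSemidef_self_mul_conjTranspose C).isHermitian
  refine ⟨c, hc, ?_⟩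
  have h₂ := h₁.mul_mul_conjTranspose_same S
  have h₃ : S * C * (S * C) = S * (C * C.conjTranspose) * S.conjTranspose := by
    conv_lhs => rw [← hR.isHermitian.eq, hR.isHermitian.eq]
    nth_rewrite 2 [← hR.isHermitian.eq]
    rw [Matrix.conjTranspose_mul]
    simp only [mul_assoc]
  rw [h₃]
  convert h₂ using 1
  rw [mul_sub, sub_mul, Matrix.mul_smul, Matrix.smul_mul, mul_one, hS.isHermitian.eq]

/-- For `V` the projection onto `Im Y`, both `tr ((1 - V) X)` and its negative `tr ((1 - V)(Y - X))`
are nonnegative, so `(1 - V) X = 0`. -/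
theorem matIm_le_of_posSemidef_sub {X Y : Mat k} (hX : X.PosSemidef)
    (h : (Y - X).PosSemidef) : matIm X ≤ matIm Y := by
  obtain ⟨V, hV, hVY⟩ := exists_starProjection (matIm Y)
  rw [← hVY, matIm_le_iff_mul_eq hV.isIdempotentElem]
  have h₁ := (matIm_le_iff_mul_eq hV.isIdempotentElem).1 hVY.ge
  have hQ := posSemidef_of_starProjection hV.one_sub
  have h₂ := trace_mul_nonneg hQ hX
  have h₃ := trace_mul_nonneg hQ h
  have h₄ : (1 - V) * (Y - X) = - ((1 - V) * X) := by
    rw [mul_sub, sub_mul 1 V Y, h₁, one_mul, sub_self, zero_sub]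
  rw [h₄, Matrix.trace_neg, neg_nonneg] at h₃
  have := mul_eq_zero_of_trace hQ hX (le_antisymm h₃ h₂)
  rw [sub_mul, one_mul, sub_eq_zero] at this
  exact this.symm

theorem mem_corner_iff {V X : Mat k} (hV : IsIdempotentElem V) :
    X ∈ corner V ↔ V * X * V = X := by
  constructor
  · rintro ⟨Y, rfl⟩
    rw [← mul_assoc, ← mul_assoc, hV.eq, mul_assoc, hV.eq]
  · intro h
    exact ⟨X, h.symm⟩

theorem mem_corner_of_isHermitian {V X : Mat k} (hV : IsStarProjection V) (hX : X.IsHermitian)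
    (h : matIm X ≤ matIm V) : X ∈ corner V := by
  rw [matIm_le_iff_mul_eq hV.isIdempotentElem] at h
  have h' := congrArg Matrix.conjTranspose h
  rw [Matrix.conjTranspose_mul, hX.eq, starProjection_conjTranspose hV] at h'
  rw [mem_corner_iff hV.isIdempotentElem, h, h']

theorem matIm_le_of_mem_corner {V X : Mat k} (h : X ∈ corner V) : matIm X ≤ matIm V := by
  obtain ⟨Y, rfl⟩ := h
  rw [mul_assoc]
  exact matIm_mul_le _ _

theorem corner_le_iff {V W : Mat k} (hV : IsStarProjection V) (hW : IsStarProjection W) :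
    corner V ≤ corner W ↔ matIm V ≤ matIm W := by
  constructor
  · intro h
    exact matIm_le_of_mem_corner (h ⟨1, by rw [mul_one, hV.isIdempotentElem.eq]⟩)
  · rintro h _ ⟨X, rfl⟩
    rw [matIm_le_iff_mul_eq hW.isIdempotentElem] at h
    have h' := congrArg Matrix.conjTranspose h
    rw [Matrix.conjTranspose_mul, starProjection_conjTranspose hV,
      starProjection_conjTranspose hW] at h'
    rw [mem_corner_iff hW.isIdempotentElem, ← mul_assoc, ← mul_assoc, h, mul_assoc, h']

/-- Since `V` is the unit of its corner, this is the polarization identity for `X Vᴴ = X`. It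
reduces claims about a whole corner to positive semidefinite elements. -/
theorem polarization {V X : Mat k} (hV : IsStarProjection V) (hX : X ∈ corner V) :
    X = ∑ j : Fin 4, ((1 / 4 : ℂ) * Complex.I ^ (j : ℕ)) •
      ((X + Complex.I ^ (j : ℕ) • V) * (X + Complex.I ^ (j : ℕ) • V).conjTranspose) := by
  rw [mem_corner_iff hV.isIdempotentElem] at hX
  have h₁ : X * V = X := by
    rw [← hX, mul_assoc, hV.isIdempotentElem.eq]
  have h₂ : V * X.conjTranspose = X.conjTranspose := by
    have := congrArg Matrix.conjTranspose h₁
    rwa [Matrix.conjTranspose_mul, starProjection_conjTranspose hV] at this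
  have h₃ := hV.isIdempotentElem.eq
  simp only [Fin.sum_univ_four, Matrix.conjTranspose_add, Matrix.conjTranspose_smul,
    starProjection_conjTranspose hV, mul_add, add_mul, Matrix.mul_smul, Matrix.smul_mul, h₁, h₂, h₃,
    smul_add, smul_smul]
  ext i j
  simp only [Matrix.add_apply, Matrix.smul_apply, smul_eq_mul]
  simp [pow_succ]
  ring_nf
  simp [Complex.I_sq]
  ring

end Mat

/-! ### Preserved subspaces, invariant corners and the adjoint. -/

namespace Mat

variable {k : ℕ}

/-- `T` maps positive semidefinite matrices with image in `U` to matrices with image in `U`. -/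
def PreservesImage (T : Mat k →ₗ[ℂ] Mat k) (U : Submodule ℂ (Fin k → ℂ)) : Prop :=
  ∀ X : Mat k, X.PosSemidef → matIm X ≤ U → matIm (T X) ≤ U

variable {T : Mat k →ₗ[ℂ] Mat k}

theorem PreservesImage.inf {U U' : Submodule ℂ (Fin k → ℂ)} (h : PreservesImage T U)
    (h' : PreservesImage T U') : PreservesImage T (U ⊓ U') :=
  fun X hX hU => le_inf (h X hX (hU.trans inf_le_left)) (h' X hX (hU.trans inf_le_right))

theorem preservesImage_top : PreservesImage T ⊤ := fun _ _ _ => le_top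

/-- One test matrix suffices: any `Z ≥ 0` supported in `Im X` satisfies `Z ≤ c X`, so `T Z ≤ c T X`.
-/
theorem preservesImage_matIm (hT : IsPositiveMap T) {X : Mat k} (hX : X.PosSemidef)
    (h : matIm (T X) ≤ matIm X) : PreservesImage T (matIm X) := by
  intro Z hZ hZX
  obtain ⟨c, -, hc⟩ := exists_smul_sub_posSemidef hZ hX hZX
  have h₁ := hT _ hc
  rw [map_sub, map_smul, ← map_smul] at h₁
  refine (matIm_le_of_posSemidef_sub (hT Z hZ) h₁).trans ?_
  rw [map_smul]
  refine le_trans ?_ h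
  simpa using matIm_mul_le (T X) ((c : ℂ) • 1)

theorem preservesImage_starProjection_iff (hT : IsPositiveMap T) {V : Mat k}
    (hV : IsStarProjection V) : PreservesImage T (matIm V) ↔ ((1 - V) * T V).trace = 0 := by
  have hVp := posSemidef_of_starProjection hV
  have key : matIm (T V) ≤ matIm V ↔ ((1 - V) * T V).trace = 0 := by
    rw [matIm_le_iff_mul_eq hV.isIdempotentElem]
    constructor
    · intro h
      rw [sub_mul, h, one_mul, sub_self, Matrix.trace_zero]
    · intro h
      have := mul_eq_zero_of_trace (posSemidef_of_starProjection hV.one_sub) (hT V hVp) h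
      rw [sub_mul, one_mul, sub_eq_zero] at this
      exact this.symm
  rw [← key]
  exact ⟨fun h => h V hVp le_rfl, preservesImage_matIm hT hVp⟩

theorem leavesCornerInvariant_iff (hT : IsPositiveMap T) {V : Mat k} (hV : IsStarProjection V) :
    LeavesCornerInvariant T V ↔ PreservesImage T (matIm V) := by
  constructor
  · intro h X hX hXV
    exact matIm_le_of_mem_corner (h X (mem_corner_of_isHermitian hV hX.isHermitian hXV))
  · intro h X hX
    rw [polarization hV hX, map_sum]
    refine Submodule.sum_mem _ fun j _ => ?_
    rw [map_smul]
    refine Submodule.smul_mem _ _ (mem_corner_of_isHermitian hV ?_ (h _ ?_ ?_))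
    · exact (hT _ (Matrix.posSemidef_self_mul_conjTranspose _)).isHermitian
    · exact Matrix.posSemidef_self_mul_conjTranspose _
    · rw [matIm_self_mul_conjTranspose, matIm_le_iff_mul_eq hV.isIdempotentElem, mul_add,
        Matrix.mul_smul, hV.isIdempotentElem.eq,
        (matIm_le_iff_mul_eq hV.isIdempotentElem).1 (matIm_le_of_mem_corner hX)]

theorem trace_mul_traceAdjoint_of_isHermitian {Y : Mat k} (T : Mat k →ₗ[ℂ] Mat k) (X : Mat k)
    (hY : Y.IsHermitian) (hY' : (traceAdjoint T Y).IsHermitian) :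
    (T X * Y).trace = (X * traceAdjoint T Y).trace := by
  have := trace_mul_traceAdjoint T X Y
  rwa [hY.eq, hY'.eq] at this

theorem dotProduct_mulVec_eq_trace (X : Mat k) (x : Fin k → ℂ) :
    star x ⬝ᵥ X.mulVec x = (Matrix.vecMulVec x (star x) * X).trace := by
  rw [Matrix.trace_mul_comm, Matrix.mul_vecMulVec, Matrix.trace_vecMulVec, dotProduct_comm]

theorem map_isHermitian (hT : IsPositiveMap T) {X : Mat k} (hX : X.IsHermitian) :
    (T X).IsHermitian := by
  obtain ⟨c, hc, h, -⟩ := exists_smul_one_sub X hX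
  have h₁ : ((c : ℂ) • (1 : Mat k)).PosSemidef := Matrix.PosSemidef.one.smul (by exact_mod_cast hc)
  have h₂ := (hT _ h₁).isHermitian.sub (hT _ h).isHermitian
  rwa [map_sub, sub_sub_cancel] at h₂

theorem map_conjTranspose (hT : IsPositiveMap T) (X : Mat k) :
    T X.conjTranspose = (T X).conjTranspose := by
  have h₁ := map_isHermitian hT (X := X + X.conjTranspose) (by
    rw [Matrix.IsHermitian, Matrix.conjTranspose_add, Matrix.conjTranspose_conjTranspose, add_comm])
  have h₂ := map_isHermitian hT (X := Complex.I • (X - X.conjTranspose)) (by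
    rw [Matrix.IsHermitian, Matrix.conjTranspose_smul, Matrix.conjTranspose_sub,
      Matrix.conjTranspose_conjTranspose, ← neg_sub, smul_neg, ← neg_smul]
    simp)
  ext i j
  have h₁' := congrFun (congrFun h₁ i) j
  have h₂' := congrFun (congrFun h₂ i) j
  simp only [map_add, map_smul, map_sub, Matrix.conjTranspose_apply, Matrix.add_apply,
    Matrix.smul_apply, Matrix.sub_apply, star_add, smul_eq_mul, Complex.star_def] at h₁' h₂' ⊢
  rw [map_mul, map_sub, Complex.conj_I] at h₂'
  linear_combination (-1 / 2) * h₁' - (Complex.I / 2) * h₂' - (1 / 2) *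
    (T X i j - T X.conjTranspose i j + (starRingEnd ℂ) (T X j i)
      - (starRingEnd ℂ) (T X.conjTranspose j i)) * Complex.I_sq

theorem isPositiveMap_traceAdjoint (hT : IsPositiveMap T) : IsPositiveMap (traceAdjoint T) := by
  intro Y hY
  have h₂ : (traceAdjoint T Y).IsHermitian := by
    ext i j
    simp only [traceAdjoint, LinearMap.coe_mk, AddHom.coe_mk, Matrix.conjTranspose_apply,
      Matrix.of_apply]
    rw [← Matrix.trace_conjTranspose, Matrix.conjTranspose_mul, Matrix.conjTranspose_conjTranspose,
      hY.isHermitian.eq, ← map_conjTranspose hT, Matrix.trace_mul_comm]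
    simp
  rw [Matrix.posSemidef_iff_dotProduct_mulVec]
  refine ⟨h₂, fun x => ?_⟩
  rw [dotProduct_mulVec_eq_trace, ← trace_mul_traceAdjoint_of_isHermitian T _ hY.isHermitian h₂]
  exact trace_mul_nonneg (hT _ (Matrix.posSemidef_vecMulVec_self_star x)) hY

/-- The trace criterion for preservation, `tr ((1 - V) T V) = 0`, is unchanged when `T` is replaced
by its adjoint and `V` by `1 - V`. -/
theorem preservesImage_traceAdjoint_iff (hT : IsPositiveMap T) {V : Mat k}
    (hV : IsStarProjection V) :
    PreservesImage (traceAdjoint T) (matIm V) ↔ PreservesImage T (matIm (1 - V)) := by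
  have hT' := isPositiveMap_traceAdjoint hT
  have hVp := posSemidef_of_starProjection hV
  rw [preservesImage_starProjection_iff hT' hV, preservesImage_starProjection_iff hT hV.one_sub,
    ← trace_mul_traceAdjoint_of_isHermitian T _ hVp.isHermitian (hT' V hVp).isHermitian,
    sub_sub_cancel, Matrix.trace_mul_comm]

theorem matIm_eq_bot_iff {X : Mat k} : matIm X = ⊥ ↔ X = 0 := by
  constructor
  · intro h
    have := (matIm_le_iff_mul_eq (V := (0 : Mat k)) (X := X) (by simp [IsIdempotentElem])).1
      (h.le.trans bot_le)
    rw [← this, zero_mul]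
  · rintro rfl
    ext x
    simp [eq_comm]

theorem isIrreducibleOn_iff (hT : IsPositiveMap T) {V : Mat k} (hV : IsStarProjection V) :
    IsIrreducibleOn T V ↔ PreservesImage T (matIm V) ∧ T V ≠ 0 ∧
      ∀ U ≤ matIm V, PreservesImage T U → U = ⊥ ∨ U = matIm V := by
  have hVc : V ∈ corner V := ⟨1, by rw [mul_one, hV.isIdempotentElem.eq]⟩
  have hVp := posSemidef_of_starProjection hV
  constructor
  · rintro ⟨h, -, h₀, h₁⟩
    refine ⟨(leavesCornerInvariant_iff hT hV).1 h, ?_, fun U hU hTU => ?_⟩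
    · intro hTV
      apply h₀
      ext1 ⟨X, hX⟩
      refine Subtype.ext ?_
      change T X = 0
      rw [polarization hV hX, map_sum]
      refine Finset.sum_eq_zero fun j _ => ?_
      rw [map_smul]
      have hp := Matrix.posSemidef_self_mul_conjTranspose (X + Complex.I ^ (j : ℕ) • V)
      obtain ⟨c, -, hc⟩ := exists_smul_sub_posSemidef hp hVp (by
        rw [matIm_self_mul_conjTranspose, matIm_le_iff_mul_eq hV.isIdempotentElem, mul_add,
          Matrix.mul_smul, hV.isIdempotentElem.eq,
          (matIm_le_iff_mul_eq hV.isIdempotentElem).1 (matIm_le_of_mem_corner hX)])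
      have h₂ := matIm_le_of_posSemidef_sub (hT _ hp) (by simpa only [map_sub] using hT _ hc)
      rw [map_smul, hTV, smul_zero, matIm_eq_bot_iff.2 rfl, le_bot_iff, matIm_eq_bot_iff] at h₂
      rw [h₂, smul_zero]
    · obtain ⟨V', hV', rfl⟩ := exists_starProjection U
      rcases h₁ V' hV' ((corner_le_iff hV' hV).2 hU)
        (fun X hX => (leavesCornerInvariant_iff hT hV').2 hTU X hX) with h | h
      · right; rw [h]
      · left; exact matIm_eq_bot_iff.2 h
  · rintro ⟨h, h₀, h₁⟩
    refine ⟨(leavesCornerInvariant_iff hT hV).2 h, fun X hX => hT X hX, ?_, ?_⟩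
    · intro h₂
      exact h₀ (congrArg Subtype.val (LinearMap.congr_fun h₂ ⟨V, hVc⟩))
    · intro V' hV' hle hinv
      have h₂ : PreservesImage T (matIm V') := by
        rw [← leavesCornerInvariant_iff hT hV']
        exact fun X hX => hinv ⟨X, (corner_le_iff hV' hV).2 ((corner_le_iff hV' hV).1 hle) hX⟩ hX
      rcases h₁ _ ((corner_le_iff hV' hV).1 hle) h₂ with h | h
      · right; exact matIm_eq_bot_iff.1 h
      · left; exact (starProjection_ext hV' hV h).symm

end Mat

/-! ### Minimal preserved subspaces, decompositions and (1) ⇒ (2). -/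

namespace Mat

variable {k : ℕ} {T : Mat k →ₗ[ℂ] Mat k}

/-- `U` is minimal among the nonzero subspaces whose image is preserved by `T`. -/
def IsMinimalPreserved (T : Mat k →ₗ[ℂ] Mat k) (U : Submodule ℂ (Fin k → ℂ)) : Prop :=
  PreservesImage T U ∧ U ≠ ⊥ ∧ ∀ U' ≤ U, PreservesImage T U' → U' = ⊥ ∨ U' = U

theorem isIrreducibleOn_iff_isMinimalPreserved (hT : IsPositiveMap T)
    (hsupp : ∀ X : Mat k, X.PosSemidef → matIm X ≤ matIm (T X)) {V : Mat k}
    (hV : IsStarProjection V) : IsIrreducibleOn T V ↔ IsMinimalPreserved T (matIm V) := by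
  have hVp := posSemidef_of_starProjection hV
  rw [isIrreducibleOn_iff hT hV]
  refine and_congr_right fun _ => and_congr_left fun _ => not_congr ?_
  rw [matIm_eq_bot_iff]
  constructor
  · intro h
    have := hsupp V hVp
    rwa [h, matIm_eq_bot_iff.2 rfl, le_bot_iff, matIm_eq_bot_iff] at this
  · rintro rfl
    exact map_zero T

theorem exists_isMinimalPreserved {U : Submodule ℂ (Fin k → ℂ)} (hU : PreservesImage T U)
    (h₀ : U ≠ ⊥) : ∃ U' ≤ U, IsMinimalPreserved T U' := by
  obtain ⟨U', ⟨h₁, h₂, h₃⟩, hmin⟩ := WellFounded.has_min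
    (wellFounded_lt (α := Submodule ℂ (Fin k → ℂ)))
    {U' | PreservesImage T U' ∧ U' ≠ ⊥ ∧ U' ≤ U} ⟨U, hU, h₀, le_rfl⟩
  refine ⟨U', h₃, h₁, h₂, fun U'' hle hU'' => ?_⟩
  by_contra! h
  exact hmin U'' ⟨hU'', h.1, hle.trans h₃⟩ (lt_of_le_of_ne hle h.2)

/-- Induction on dimension: a minimal `M ≤ U` with preserved complement `N` splits off, since `U = M
⊔ (N ⊓ U)` by the modular law and `N ⊓ U` is again preserved and smaller. -/
theorem exists_decomposition_aux
    (hc : ∀ U, IsMinimalPreserved T U → ∃ U', PreservesImage T U' ∧ IsCompl U U') (d : ℕ) :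
    ∀ U, PreservesImage T U → Module.finrank ℂ U ≤ d →
      ∃ (s : ℕ) (F : Fin s → Submodule ℂ (Fin k → ℂ)), (∀ i, IsMinimalPreserved T (F i)) ∧
        iSupIndep F ∧ ⨆ i, F i = U := by
  induction d with
  | zero =>
    intro U _ hd
    have : U = ⊥ := Submodule.finrank_eq_zero.1 (Nat.le_zero.1 hd)
    subst this
    exact ⟨0, Fin.elim0, fun i => i.elim0, fun i => i.elim0, by simp⟩
  | succ d ih =>
    intro U hU hd
    by_cases h₀ : U = ⊥
    · subst h₀
      exact ⟨0, Fin.elim0, fun i => i.elim0, fun i => i.elim0, by simp⟩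
    obtain ⟨M, hMU, hM⟩ := exists_isMinimalPreserved hU h₀
    obtain ⟨N, hN, hMN⟩ := hc M hM
    have hsup : M ⊔ N ⊓ U = U := by
      rw [← sup_inf_assoc_of_le N hMU, hMN.sup_eq_top, top_inf_eq]
    have hdisj : Disjoint M (N ⊓ U) := hMN.disjoint.mono_right inf_le_left
    have hlt : N ⊓ U < U := by
      refine lt_of_le_of_ne inf_le_right fun h => hM.2.1 ?_
      rw [h] at hdisj
      exact hdisj.eq_bot_of_le hMU
    obtain ⟨s, F, hF, hind, hF'⟩ := ih (N ⊓ U) (hN.inf hU)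
      (Nat.le_of_lt_succ ((Submodule.finrank_lt_finrank_of_lt hlt).trans_le hd))
    refine ⟨s + 1, Fin.cons M F, ?_, ?_, ?_⟩
    · intro i
      refine Fin.cases ?_ (fun j => ?_) i
      · simpa using hM
      · simpa using hF j
    · rw [iSupIndep_iff_supIndep_univ, Fin.univ_succ, Finset.cons_eq_insert]
      refine Finset.SupIndep.insert ?_ ?_
      · rw [Finset.supIndep_map]
        exact (iSupIndep_iff_supIndep_univ.1 hind).mono fun i _ => by simp
      · rw [Finset.sup_map]
        refine hdisj.mono_right ?_
        rw [← hF', Finset.sup_univ_eq_iSup]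
        simp [Function.comp_def]
    · rw [← Finset.sup_univ_eq_iSup, Fin.univ_succ, Finset.sup_cons, Finset.sup_map,
        Finset.sup_univ_eq_iSup]
      simpa [Function.comp_def, hF'] using hsup

theorem exists_decomposition
    (hT : IsPositiveMap T)
    (hsupp : ∀ X : Mat k, X.PosSemidef → matIm X ≤ matIm (T X))
    (hc : ∀ U, IsMinimalPreserved T U → ∃ U', PreservesImage T U' ∧ IsCompl U U') :
    ∃ (s : ℕ) (V : Fin s → Mat k),
        (∀ i, IsStarProjection (V i)) ∧
        DirectSum.IsInternal (fun i => matIm (V i)) ∧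
        ∀ i, IsIrreducibleOn T (V i) := by
  obtain ⟨s, F, hF, hind, hF'⟩ := exists_decomposition_aux hc _ ⊤ preservesImage_top le_rfl
  choose V hV hVF using fun i => exists_starProjection (F i)
  refine ⟨s, V, hV, ?_, fun i => ?_⟩
  · simp only [hVF]
    exact (DirectSum.isInternal_submodule_iff_iSupIndep_and_iSup_eq_top F).2 ⟨hind, hF'⟩
  · rw [isIrreducibleOn_iff_isMinimalPreserved hT hsupp (hV i), hVF]
    exact hF i

theorem exists_linearEquiv_of_isUnit {R : Mat k} (hR : IsUnit R) :
    ∃ e : (Fin k → ℂ) ≃ₗ[ℂ] (Fin k → ℂ), e.toLinearMap = R.mulVecLin :=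
  ⟨LinearEquiv.ofBijective R.mulVecLin ⟨Matrix.mulVec_injective_iff_isUnit.2 hR,
    Matrix.mulVec_surjective_iff_isUnit.2 hR⟩, rfl⟩

theorem finrank_map_mulVecLin {R : Mat k} (hR : IsUnit R) (U : Submodule ℂ (Fin k → ℂ)) :
    Module.finrank ℂ (U.map R.mulVecLin) = Module.finrank ℂ U := by
  obtain ⟨e, he⟩ := exists_linearEquiv_of_isUnit hR
  rw [← he]
  exact e.finrank_map_eq U

theorem isCompl_map_mulVecLin {R : Mat k} (hR : IsUnit R) {U U' : Submodule ℂ (Fin k → ℂ)}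
    (h : IsCompl U U') : IsCompl (U.map R.mulVecLin) (U'.map R.mulVecLin) := by
  obtain ⟨e, he⟩ := exists_linearEquiv_of_isUnit hR
  rw [← he]
  exact (Submodule.orderIsoMapComap e).isCompl h

theorem isCompl_matIm_one_sub {P : Mat k} (hP : IsIdempotentElem P) :
    IsCompl (matIm P) (matIm (1 - P)) := by
  rw [← matKer_eq_matIm_one_sub hP]
  refine LinearMap.IsIdempotentElem.isCompl ?_
  rw [IsIdempotentElem, Module.End.mul_eq_comp, ← Matrix.mulVecLin_mul, hP.eq]

theorem isIdempotentElem_finrank_add {P : Mat k} (hP : IsIdempotentElem P) :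
    Module.finrank ℂ (matIm P) + Module.finrank ℂ (matIm (1 - P)) = k := by
  rw [← matKer_eq_matIm_one_sub hP]
  simpa using LinearMap.finrank_range_add_finrank_ker P.mulVecLin

theorem matIm_mul (X Y : Mat k) : matIm (X * Y) = (matIm Y).map X.mulVecLin := by
  rw [matIm, Matrix.mulVecLin_mul, LinearMap.range_comp]

theorem matIm_mul_isUnit (X : Mat k) {R : Mat k} (hR : IsUnit R) : matIm (X * R) = matIm X := by
  obtain ⟨R', h⟩ := hR.exists_right_inv
  refine le_antisymm (matIm_mul_le _ _) ?_
  have := matIm_mul_le (X * R) R'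
  rwa [mul_assoc, h, mul_one] at this

theorem matIm_conj {R P : Mat k} (hR : IsUnit R) :
    matIm (R * P * R.conjTranspose) = (matIm P).map R.mulVecLin := by
  rw [matIm_mul_isUnit _ (by simpa using hR.star), matIm_mul]

/-- A map equivalent to a doubly stochastic one has, for every preserved subspace, a preserved
complement. -/
theorem exists_isCompl_of_mapEquivalent (hT : IsPositiveMap T)
    (hsupp : ∀ X : Mat k, X.PosSemidef → matIm X ≤ matIm (T X)) {L : Mat k →ₗ[ℂ] Mat k}
    (hL : IsDoublyStochastic L) (hTL : MapEquivalent T L) {U : Submodule ℂ (Fin k → ℂ)}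
    (hU : PreservesImage T U) : ∃ U', PreservesImage T U' ∧ IsCompl U U' := by
  obtain ⟨R, S, hR, hS, hL'⟩ := hTL
  obtain ⟨hLp, hL₁, hL₂⟩ := hL
  have htr : ∀ X, (L X).trace = X.trace := by
    intro X
    have := trace_mul_traceAdjoint L X 1
    simpa [hL₂] using this
  obtain ⟨P, hP, hPU⟩ := exists_starProjection (U.comap R.mulVecLin)
  obtain ⟨Q, hQ, hQU⟩ := exists_starProjection (U.map S.mulVecLin)
  have hRsurj : Function.Surjective R.mulVecLin := Matrix.mulVec_surjective_iff_isUnit.2 hR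
  have hRP : (matIm P).map R.mulVecLin = U := by
    rw [hPU, Submodule.map_comap_eq_of_surjective hRsurj]
  have hfin : Module.finrank ℂ (matIm P) = Module.finrank ℂ (matIm Q) := by
    rw [hQU, finrank_map_mulVecLin hS, ← finrank_map_mulVecLin hR (matIm P), hRP]
  have hPp := posSemidef_of_starProjection hP
  have hPp' := posSemidef_of_starProjection hP.one_sub
  -- `L P` is supported in `Q` and `L P ≤ L 1 = 1`, so compressing by `Q` gives `L P ≤ Q`. The
  -- traces agree because `L` preserves the trace and `P`, `Q` have equal rank.
  have hLP : L P = Q := by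
    have h₁ : Q * L P = L P := by
      rw [← matIm_le_iff_mul_eq hQ.isIdempotentElem, hL', matIm_conj hS, hQU]
      refine Submodule.map_mono (hU _ (hPp.mul_mul_conjTranspose_same R) ?_)
      rw [matIm_conj hR, hRP]
    have h₂ : L P * Q = L P := by
      have := congrArg Matrix.conjTranspose h₁
      rwa [Matrix.conjTranspose_mul, (hLp P hPp).isHermitian.eq,
        starProjection_conjTranspose hQ] at this
    refine eq_of_posSemidef_sub_of_trace ?_ ?_
    · have := (hLp _ hPp').mul_mul_conjTranspose_same Q
      rwa [map_sub, hL₁, starProjection_conjTranspose hQ, mul_sub, sub_mul, mul_one,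
        hQ.isIdempotentElem.eq, h₁, h₂] at this
    · rw [htr, trace_starProjection hP.isIdempotentElem, trace_starProjection hQ.isIdempotentElem,
        hfin]
  have hLP' : L (1 - P) = 1 - Q := by rw [map_sub, hL₁, hLP]
  have hZ := hPp'.mul_mul_conjTranspose_same R
  -- `L` sends `1 - P` to `1 - Q`, of the same rank, so `T` does not raise the rank of `R (1 - P)
  -- Rᴴ`. The support condition then makes the two images equal.
  have hfin' : Module.finrank ℂ (matIm (T (R * (1 - P) * R.conjTranspose))) =
      Module.finrank ℂ (matIm (R * (1 - P) * R.conjTranspose)) := by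
    rw [matIm_conj hR, finrank_map_mulVecLin hR, ← finrank_map_mulVecLin hS, ← matIm_conj hS, ← hL',
      hLP']
    have h₁ := isIdempotentElem_finrank_add hP.isIdempotentElem
    have h₂ := isIdempotentElem_finrank_add hQ.isIdempotentElem
    omega
  have hinv := preservesImage_matIm hT hZ
    (Submodule.eq_of_le_of_finrank_eq (hsupp _ hZ) hfin'.symm).ge
  refine ⟨_, hinv, ?_⟩
  rw [matIm_conj hR]
  nth_rewrite 1 [← hRP]
  exact isCompl_map_mulVecLin hR (isCompl_matIm_one_sub hP.isIdempotentElem)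

end Mat

/-! ### PPT matrices give block diagonal maps. -/

namespace Mat

variable {k : ℕ}

/-- The matrix of `u ↦ conj x ⊗ u`. -/
def conjTensor (x : Fin k → ℂ) : Matrix (Fin k × Fin k) (Fin k) ℂ :=
  Matrix.of fun p d => if p.2 = d then star (x p.1) else 0

theorem mapGT_vecMulVec (A : BiMat k k) (x y : Fin k → ℂ) :
    mapGT A (Matrix.vecMulVec y (star x)) = (conjTensor y).conjTranspose * A * conjTensor x := by
  ext b d
  simp only [mapGT_apply, mapG, LinearMap.coe_mk, AddHom.coe_mk, Matrix.of_apply, conjTensor,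
    Matrix.mul_apply, Matrix.conjTranspose_apply, Fintype.sum_prod_type, Matrix.transpose_apply,
    Matrix.vecMulVec_apply, apply_ite star, star_star, star_zero, ite_mul, zero_mul, mul_ite,
    mul_zero, Finset.sum_ite_eq', Finset.mem_univ, if_true, Pi.star_apply, Finset.sum_mul]
  rw [Finset.sum_comm]
  refine Finset.sum_congr rfl fun a _ => Finset.sum_congr rfl fun c _ => ?_
  ring

theorem mul_eq_sum_vecMulVec (X Y : Mat k) :
    X * Y.conjTranspose = ∑ j, Matrix.vecMulVec (X.col j) (star (Y.col j)) := by
  ext a c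
  simp [Matrix.mul_apply, Matrix.sum_apply, Matrix.vecMulVec_apply]

theorem isPositiveMap_mapGT {A : BiMat k k} (hA : A.PosSemidef) : IsPositiveMap (mapGT A) := by
  intro X hX
  obtain ⟨R, hR, rfl⟩ := exists_posSemidef_sqrt hX
  nth_rewrite 2 [← hR.isHermitian.eq]
  rw [mul_eq_sum_vecMulVec, map_sum]
  refine Matrix.posSemidef_sum _ fun j _ => ?_
  rw [mapGT_vecMulVec]
  exact hA.conjTranspose_mul_mul_same _

theorem mapGT_partialTranspose (A : BiMat k k) (X : Mat k) :
    mapGT (partialTranspose A) X = (mapGT A X).transpose := by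
  ext b d
  simp [mapGT_apply, mapG, partialTranspose]

/-- If `C x` denotes `conjTensor x`, then `T (y xᴴ) = (C y)ᴴ A (C x)`. Pairing `T (x xᴴ) u = 0` with
`u` gives `A (C x) u = 0` since `A ≥ 0`, and this no longer involves `y`. -/
theorem mapGT_mulVec_eq_zero {A : BiMat k k} (hA : A.PosSemidef) {x u : Fin k → ℂ}
    (h : (mapGT A (Matrix.vecMulVec x (star x))).mulVec u = 0) (y : Fin k → ℂ) :
    (mapGT A (Matrix.vecMulVec y (star x))).mulVec u = 0 := by
  rw [mapGT_vecMulVec] at h ⊢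
  have h₁ := congrArg (star u ⬝ᵥ ·) h
  simp only [dotProduct_zero, ← Matrix.mulVec_mulVec] at h₁
  rw [Matrix.dotProduct_mulVec, ← Matrix.star_mulVec, hA.dotProduct_mulVec_zero_iff] at h₁
  rw [← Matrix.mulVec_mulVec, ← Matrix.mulVec_mulVec, h₁, Matrix.mulVec_zero]

/-- The corner property of maps coming from PPT matrices. -/
theorem mapGT_mem_corner {A : BiMat k k} (hA : IsPPT A) {V X : Mat k} (hV : IsStarProjection V)
    (hAV : PreservesImage (mapGT A) (matIm V)) (hX : X * V = X) : mapGT A X ∈ corner V := by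
  have hpos := isPositiveMap_mapGT hA.1
  have hVc := starProjection_conjTranspose hV
  have hX' : X = ∑ j, Matrix.vecMulVec (X.col j) (star (V.col j)) := by
    rw [← mul_eq_sum_vecMulVec, hVc, hX]
  have hcol : ∀ j, V * mapGT A (Matrix.vecMulVec (V.col j) (star (V.col j))) =
      mapGT A (Matrix.vecMulVec (V.col j) (star (V.col j))) := by
    intro j
    rw [← matIm_le_iff_mul_eq hV.isIdempotentElem]
    refine hAV _ (Matrix.posSemidef_vecMulVec_self_star _) ?_
    rw [matIm_le_iff_mul_eq hV.isIdempotentElem, Matrix.mul_vecMulVec]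
    congr 1
    ext i
    exact congrFun (congrFun hV.isIdempotentElem.eq i) j
  have hcol' : ∀ j, mapGT A (Matrix.vecMulVec (V.col j) (star (V.col j))) * V =
      mapGT A (Matrix.vecMulVec (V.col j) (star (V.col j))) := by
    intro j
    have := congrArg Matrix.conjTranspose (hcol j)
    rwa [Matrix.conjTranspose_mul, hVc,
      (hpos _ (Matrix.posSemidef_vecMulVec_self_star _)).isHermitian.eq] at this
  have h₁ : mapGT A X * (1 - V) = 0 := by
    refine Matrix.ext_of_mulVec_single fun i => ?_
    rw [hX', map_sum, ← Matrix.mulVec_mulVec, Matrix.sum_mulVec, Matrix.zero_mulVec]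
    refine Finset.sum_eq_zero fun j _ => mapGT_mulVec_eq_zero hA.1 ?_ _
    rw [Matrix.mulVec_mulVec, mul_sub, hcol', mul_one, sub_self, Matrix.zero_mulVec]
  -- Positivity of `A` controls `T X` on the right only. The partial transpose induces the
  -- transposed map, so its positivity yields the same control on the left.
  have h₂ : (mapGT A X).transpose * (1 - V).transpose = 0 := by
    refine Matrix.ext_of_mulVec_single fun i => ?_
    rw [← mapGT_partialTranspose, hX', map_sum, ← Matrix.mulVec_mulVec, Matrix.sum_mulVec,
      Matrix.zero_mulVec]
    refine Finset.sum_eq_zero fun j _ => mapGT_mulVec_eq_zero hA.2 ?_ _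
    rw [Matrix.mulVec_mulVec, mapGT_partialTranspose, ← Matrix.transpose_mul, sub_mul, hcol,
      one_mul, sub_self, Matrix.transpose_zero, Matrix.zero_mulVec]
  rw [← Matrix.transpose_mul, Matrix.transpose_eq_zero, sub_mul, one_mul, sub_eq_zero] at h₂
  rw [mul_sub, mul_one, sub_eq_zero] at h₁
  rw [mem_corner_iff hV.isIdempotentElem, ← h₂, ← h₁]

theorem mapGT_mem_corner' {A : BiMat k k} (hA : IsPPT A) {V X : Mat k} (hV : IsStarProjection V)
    (hAV : PreservesImage (mapGT A) (matIm V)) (hX : V * X = X) : mapGT A X ∈ corner V := by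
  have h : X.conjTranspose * V = X.conjTranspose := by
    have := congrArg Matrix.conjTranspose hX
    rwa [Matrix.conjTranspose_mul, starProjection_conjTranspose hV] at this
  have h₁ := mapGT_mem_corner hA hV hAV h
  rw [mem_corner_iff hV.isIdempotentElem] at h₁ ⊢
  have h₂ := congrArg Matrix.conjTranspose h₁
  rwa [map_conjTranspose (isPositiveMap_mapGT hA.1), Matrix.conjTranspose_mul,
    Matrix.conjTranspose_mul, Matrix.conjTranspose_conjTranspose,
    starProjection_conjTranspose hV, ← mul_assoc] at h₂

/-- `p` is a complete system of idempotents with respect to which `T` is block diagonal. -/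
structure IsBlockSystem {s : ℕ} (T : Mat k →ₗ[ℂ] Mat k) (p : Fin s → Mat k) : Prop where
  sum_eq : ∑ i, p i = 1
  mul_self : ∀ i, p i * p i = p i
  mul_of_ne : ∀ i j, i ≠ j → p i * p j = 0
  map_of_ne : ∀ i j, i ≠ j → ∀ X, T (p i * X * (p j).conjTranspose) = 0
  mul_map : ∀ i X, p i * T X = T (p i * X * (p i).conjTranspose)

theorem IsBlockSystem.map_mul {s : ℕ} {T : Mat k →ₗ[ℂ] Mat k} (hT : IsPositiveMap T)
    {p : Fin s → Mat k} (h : IsBlockSystem T p) (i : Fin s) (X : Mat k) :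
    T X * (p i).conjTranspose = T (p i * X * (p i).conjTranspose) := by
  have := congrArg Matrix.conjTranspose (h.mul_map i X.conjTranspose)
  rw [Matrix.conjTranspose_mul, ← map_conjTranspose hT, ← map_conjTranspose hT] at this
  simpa [Matrix.conjTranspose_mul, mul_assoc] using this

theorem exists_idempotents {s : ℕ} {F : Fin s → Submodule ℂ (Fin k → ℂ)}
    (hF : DirectSum.IsInternal F) : ∃ p : Fin s → Mat k, ∑ i, p i = 1 ∧
      (∀ i, p i * p i = p i) ∧ (∀ i j, i ≠ j → p i * p j = 0) ∧ ∀ i, matIm (p i) = F i := by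
  have hind := hF.submodule_iSupIndep
  have htop := hF.submodule_iSup_eq_top
  have hc : ∀ i, IsCompl (F i) (⨆ (j) (_ : j ≠ i), F j) := by
    intro i
    refine ⟨hind i, codisjoint_iff.2 ?_⟩
    rw [eq_top_iff, ← htop]
    refine iSup_le fun j => ?_
    by_cases h : j = i
    · rw [h]; exact le_sup_left
    · exact le_sup_of_le_right (le_iSup₂_of_le j h le_rfl)
  let p : Fin s → Mat k := fun i => LinearMap.toMatrix' (Submodule.projection _ _ (hc i))
  have hp : ∀ i x, (p i).mulVec x = Submodule.projection _ _ (hc i) x := by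
    intro i x
    rw [← Matrix.toLin'_apply, Matrix.toLin'_toMatrix']
  have hp₁ : ∀ i, ∀ x ∈ F i, (p i).mulVec x = x := by
    intro i x hx
    rw [hp]
    exact Submodule.projection_apply_left (hc i) ⟨x, hx⟩
  have hp₂ : ∀ i j, i ≠ j → ∀ x ∈ F j, (p i).mulVec x = 0 := by
    intro i j hij x hx
    rw [hp, Submodule.projection_apply_eq_zero_iff]
    exact (le_iSup₂_of_le (f := fun (j : Fin s) (_ : j ≠ i) => F j) j hij.symm le_rfl) hx
  have hpF : ∀ i x, (p i).mulVec x ∈ F i := by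
    intro i x
    rw [hp]
    exact Submodule.projection_apply_mem (hc i) x
  refine ⟨p, ?_, ?_, ?_, ?_⟩
  · refine Matrix.ext_of_mulVec_single fun i => ?_
    generalize (Pi.single i 1 : Fin k → ℂ) = x
    rw [Matrix.one_mulVec, Matrix.sum_mulVec]
    have hx : x ∈ ⨆ i, F i := by rw [htop]; trivial
    induction hx using Submodule.iSup_induction' with
    | mem i x hx =>
      rw [Finset.sum_eq_single i (fun j _ hj => hp₂ j i hj x hx) (by simp), hp₁ i x hx]
    | zero => simp
    | add x y _ _ hx hy => simp only [Matrix.mulVec_add, Finset.sum_add_distrib, hx, hy]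
  · intro i
    refine Matrix.ext_of_mulVec_single fun l => ?_
    rw [← Matrix.mulVec_mulVec, hp₁ i _ (hpF i _)]
  · intro i j hij
    refine Matrix.ext_of_mulVec_single fun l => ?_
    rw [← Matrix.mulVec_mulVec, hp₂ i j hij _ (hpF j _), Matrix.zero_mulVec]
  · intro i
    ext x
    constructor
    · rintro ⟨y, rfl⟩
      exact hpF i y
    · intro hx
      exact ⟨x, hp₁ i x hx⟩

theorem exists_isBlockSystem {A : BiMat k k} (hA : IsPPT A) {s : ℕ} {V : Fin s → Mat k}
    (hV : ∀ i, IsStarProjection (V i)) (hF : DirectSum.IsInternal fun i => matIm (V i))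
    (hAV : ∀ i, PreservesImage (mapGT A) (matIm (V i))) :
    ∃ p : Fin s → Mat k, IsBlockSystem (mapGT A) p ∧ ∀ i, matIm (p i) = matIm (V i) := by
  obtain ⟨p, h₁, h₂, h₃, h₄⟩ := exists_idempotents hF
  have hVp : ∀ i, V i * p i = p i := fun i =>
    (matIm_le_iff_mul_eq (hV i).isIdempotentElem).1 (h₄ i).le
  have hpV : ∀ i, (p i).conjTranspose * V i = (p i).conjTranspose := by
    intro i
    have := congrArg Matrix.conjTranspose (hVp i)
    rwa [Matrix.conjTranspose_mul, starProjection_conjTranspose (hV i)] at this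
  have hp : ∀ i X, mapGT A X ∈ corner (V i) → p i * mapGT A X = mapGT A X := fun i X hX =>
    (matIm_le_iff_mul_eq (h₂ i)).1 ((matIm_le_of_mem_corner hX).trans (h₄ i).ge)
  have hl : ∀ i X, mapGT A (p i * X) ∈ corner (V i) := fun i X =>
    mapGT_mem_corner' hA (hV i) (hAV i) (by rw [← mul_assoc, hVp])
  have hr : ∀ i X, mapGT A (X * (p i).conjTranspose) ∈ corner (V i) := fun i X =>
    mapGT_mem_corner hA (hV i) (hAV i) (by rw [mul_assoc, hpV])
  -- The value lies in the corners of both `V i` and `V j`, so it is fixed by left multiplication by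
  -- `p i` and by `p j`, whose product is zero.
  have hoff : ∀ i j, i ≠ j → ∀ X, mapGT A (p i * X * (p j).conjTranspose) = 0 := by
    intro i j hij X
    rw [← hp j _ (hr j _), ← hp i (p i * X * _) (by rw [mul_assoc]; exact hl i _), ← mul_assoc,
      h₃ j i hij.symm, zero_mul]
  have hsum : ∀ X, mapGT A X = ∑ i, mapGT A (p i * X * (p i).conjTranspose) := by
    intro X
    have hX : X = ∑ i, ∑ j, p i * X * (p j).conjTranspose := by
      simp_rw [← Finset.mul_sum, ← Finset.sum_mul]
      rw [← Matrix.conjTranspose_sum, h₁]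
      simp
    conv_lhs => rw [hX]
    simp_rw [map_sum]
    exact Finset.sum_congr rfl fun i _ =>
      Finset.sum_eq_single i (fun j _ hj => hoff i j hj.symm X) (by simp)
  refine ⟨p, ⟨h₁, h₂, h₃, hoff, fun i X => ?_⟩, h₄⟩
  rw [hsum X, Finset.mul_sum, Finset.sum_eq_single i _ (by simp)]
  · exact hp i _ (hr i _)
  · intro j _ hj
    rw [← hp j _ (hr j _), ← mul_assoc, h₃ i j hj.symm, zero_mul]

end Mat

/-! ### Block diagonal maps: preserved subspaces, adjoint and spectrum. -/

namespace Mat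

variable {k : ℕ} {T : Mat k →ₗ[ℂ] Mat k}

section Blocks

variable {s : ℕ} {p : Fin s → Mat k}

theorem mem_matKer {X : Mat k} {x : Fin k → ℂ} : x ∈ matKer X ↔ X.mulVec x = 0 := by
  rw [LinearMap.mem_ker, Matrix.mulVecLin_apply]

theorem matIm_le_matKer_iff {X Y : Mat k} : matIm X ≤ matKer Y ↔ Y * X = 0 := by
  constructor
  · intro h
    refine Matrix.ext_of_mulVec_single fun i => ?_
    rw [← Matrix.mulVec_mulVec, Matrix.zero_mulVec]
    exact mem_matKer.1 (h ⟨_, rfl⟩)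
  · rintro h _ ⟨x, rfl⟩
    rw [mem_matKer, Matrix.mulVecLin_apply, Matrix.mulVec_mulVec, h, Matrix.zero_mulVec]

/-- For `V` the projection onto `U`, the support condition bounds `Im (p i V)` by the image of `T (p
i V (p i)ᴴ) = T V (p i)ᴴ`, which is inside `Im (T V) ≤ U`. -/
theorem IsBlockSystem.mulVec_mem (hT : IsPositiveMap T)
    (hsupp : ∀ X : Mat k, X.PosSemidef → matIm X ≤ matIm (T X)) (h : IsBlockSystem T p)
    {U : Submodule ℂ (Fin k → ℂ)} (hU : PreservesImage T U) (i : Fin s) {x : Fin k → ℂ}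
    (hx : x ∈ U) : (p i).mulVec x ∈ U := by
  obtain ⟨V, hV, rfl⟩ := exists_starProjection U
  have hVp := posSemidef_of_starProjection hV
  have h₁ : matIm (p i * V) ≤ matIm V := by
    rw [← matIm_self_mul_conjTranspose, Matrix.conjTranspose_mul, starProjection_conjTranspose hV,
      ← mul_assoc, mul_assoc _ V V, hV.isIdempotentElem.eq]
    refine (hsupp _ (hVp.mul_mul_conjTranspose_same (p i))).trans ?_
    rw [← h.map_mul hT]
    exact (matIm_mul_le _ _).trans (hU V hVp le_rfl)
  rw [mem_matIm_iff hV.isIdempotentElem] at hx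
  rw [← hx, Matrix.mulVec_mulVec]
  exact h₁ ⟨x, rfl⟩

theorem IsBlockSystem.preservesImage_matKer (h : IsBlockSystem T p) (i : Fin s) :
    PreservesImage T (matKer (p i)) := by
  intro X _ hX
  rw [matIm_le_matKer_iff] at hX ⊢
  rw [h.mul_map, hX, zero_mul, map_zero]

/-- A nonzero vector of `U` has a nonzero component `p i x`, which stays in `U`. So `U` meets `Im (p
i)` in a nonzero preserved subspace, and both are minimal. -/
theorem IsBlockSystem.eq_matIm (hT : IsPositiveMap T)
    (hsupp : ∀ X : Mat k, X.PosSemidef → matIm X ≤ matIm (T X)) (h : IsBlockSystem T p)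
    (hp : ∀ i, IsMinimalPreserved T (matIm (p i))) {U : Submodule ℂ (Fin k → ℂ)}
    (hU : IsMinimalPreserved T U) : ∃ i, U = matIm (p i) := by
  obtain ⟨x, hx, hx₀⟩ := (Submodule.ne_bot_iff U).1 hU.2.1
  have hsum : ∑ i, (p i).mulVec x = x := by
    rw [← Matrix.sum_mulVec, h.sum_eq, Matrix.one_mulVec]
  obtain ⟨i, hi⟩ : ∃ i, (p i).mulVec x ≠ 0 := by
    by_contra! hc
    exact hx₀ (by rw [← hsum, Finset.sum_eq_zero fun i _ => hc i])
  have hne : U ⊓ matIm (p i) ≠ ⊥ := (Submodule.ne_bot_iff _).2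
    ⟨_, ⟨h.mulVec_mem hT hsupp hU.1 i hx, ⟨x, rfl⟩⟩, hi⟩
  have hinv := hU.1.inf (hp i).1
  refine ⟨i, ?_⟩
  rw [← (hU.2.2 _ inf_le_left hinv).resolve_left hne]
  exact ((hp i).2.2 _ inf_le_right hinv).resolve_left hne

theorem IsBlockSystem.le_matKer (hT : IsPositiveMap T)
    (hsupp : ∀ X : Mat k, X.PosSemidef → matIm X ≤ matIm (T X)) (h : IsBlockSystem T p)
    {U : Submodule ℂ (Fin k → ℂ)} (hU : PreservesImage T U) {i : Fin s}
    (hd : U ⊓ matIm (p i) = ⊥) : U ≤ matKer (p i) := by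
  intro x hx
  rw [mem_matKer]
  exact (Submodule.eq_bot_iff _).1 hd _ ⟨h.mulVec_mem hT hsupp hU i hx, ⟨x, rfl⟩⟩

theorem finrank_matIm_add_matKer (X : Mat k) :
    Module.finrank ℂ (matIm X) + Module.finrank ℂ (matKer X) = k := by
  simpa using LinearMap.finrank_range_add_finrank_ker X.mulVecLin

/-- Subspaces of `Im W` preserved by the adjoint have as orthogonal complements the preserved
subspaces of `T` containing `ker (p i)`. Intersecting these with the minimal `Im (p i)` leaves only
`ker (p i)` and the whole space. -/
theorem IsBlockSystem.isIrreducibleOn_traceAdjoint (hT : IsPositiveMap T)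
    (hsupp : ∀ X : Mat k, X.PosSemidef → matIm X ≤ matIm (T X)) (h : IsBlockSystem T p)
    (hp : ∀ i, IsMinimalPreserved T (matIm (p i))) {i : Fin s} {W : Mat k}
    (hW : IsStarProjection W) (hWp : matKer W = matKer (p i)) :
    IsIrreducibleOn (traceAdjoint T) W := by
  have hT' := isPositiveMap_traceAdjoint hT
  have hWpos := posSemidef_of_starProjection hW
  have hW₁ := matKer_eq_matIm_one_sub hW.isIdempotentElem
  refine (isIrreducibleOn_iff hT' hW).2 ⟨?_, ?_, ?_⟩
  · rw [preservesImage_traceAdjoint_iff hT hW, ← hW₁, hWp]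
    exact h.preservesImage_matKer i
  · intro h₀
    have h₁ := trace_mul_traceAdjoint_of_isHermitian T 1 hWpos.isHermitian
      (hT' W hWpos).isHermitian
    rw [h₀, mul_zero, Matrix.trace_zero, Matrix.trace_mul_comm] at h₁
    have h₂ := mul_eq_zero_of_trace hWpos (hT 1 Matrix.PosSemidef.one) h₁
    obtain ⟨C, hC⟩ := exists_mul_eq_of_matIm_le (hsupp 1 Matrix.PosSemidef.one)
    have hW₀ : W = 0 := by rw [← mul_one W, hC, ← mul_assoc, h₂, zero_mul]
    have h₃ := finrank_matIm_add_matKer W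
    have h₄ := finrank_matIm_add_matKer (p i)
    rw [hWp, matIm_eq_bot_iff.2 hW₀, finrank_bot] at h₃
    exact (hp i).2.1 (Submodule.finrank_eq_zero.1 (by omega))
  · intro U hU hTU
    obtain ⟨W', hW', rfl⟩ := exists_starProjection U
    rw [preservesImage_traceAdjoint_iff hT hW'] at hTU
    have hle : matKer (p i) ≤ matIm (1 - W') := by
      rw [matIm_le_iff_mul_eq hW.isIdempotentElem] at hU
      have hU' := congrArg Matrix.conjTranspose hU
      rw [Matrix.conjTranspose_mul, starProjection_conjTranspose hW,
        starProjection_conjTranspose hW'] at hU'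
      rw [← hWp, hW₁, matIm_le_iff_mul_eq hW'.isIdempotentElem.one_sub, sub_mul, mul_sub, mul_sub,
        hU']
      simp
    rcases (hp i).2.2 _ inf_le_right (hTU.inf (hp i).1) with h₁ | h₁
    · right
      have h₂ : matIm (1 - W') = matIm (1 - W) := by
        rw [← hW₁, hWp]
        exact le_antisymm (h.le_matKer hT hsupp hTU h₁) hle
      have h₃ := starProjection_ext hW'.one_sub hW.one_sub h₂
      rw [sub_right_inj.1 h₃]
    · left
      have h₂ : matIm (1 - W') = ⊤ := by
        rw [eq_top_iff]
        intro x _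
        have hx : x = (p i).mulVec x + (x - (p i).mulVec x) := by abel
        rw [hx]
        refine Submodule.add_mem _ (h₁.ge.trans inf_le_left ⟨x, rfl⟩) (hle ?_)
        rw [mem_matKer, Matrix.mulVec_sub, Matrix.mulVec_mulVec, h.mul_self, sub_self]
      rw [← matKer_eq_matIm_one_sub hW'.isIdempotentElem] at h₂
      rw [matIm_eq_bot_iff, ← mul_one W', ← matIm_le_matKer_iff, h₂]
      exact le_top

end Blocks

section Spectrum

theorem exists_sub_smul_eq_of_not_hasEigenvalue {E : Type*} [AddCommGroup E] [Module ℂ E]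
    [FiniteDimensional ℂ E] {f : Module.End ℂ E} {μ : ℂ} (h : ¬ f.HasEigenvalue μ) (y : E) :
    ∃ z, f z - μ • z = y := by
  have hinj : Function.Injective (f - μ • (1 : Module.End ℂ E)) := by
    rw [← LinearMap.ker_eq_bot, ← Module.End.eigenspace_def]
    exact not_not.1 h
  obtain ⟨z, hz⟩ := LinearMap.injective_iff_surjective.1 hinj y
  exact ⟨z, by simpa using hz⟩

/-- Nondegeneracy of the trace pairing between two corners when `W` is injective on `Im V`. Testing
against `W X W` gives `W X W = 0`; injectivity removes `W` from one side, then from the other after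
taking adjoints. -/
theorem eq_zero_of_trace_corner {V W : Mat k} (hV : IsStarProjection V) (hW : IsStarProjection W)
    (hVW : ∀ Z, V * Z = Z → W * Z = 0 → Z = 0) {X : Mat k} (hX : X ∈ corner V)
    (h : ∀ Y ∈ corner W, (X * Y.conjTranspose).trace = 0) : X = 0 := by
  have hWc := starProjection_conjTranspose hW
  have hVX := (matIm_le_iff_mul_eq hV.isIdempotentElem).1 (matIm_le_of_mem_corner hX)
  have hVX' : V * X.conjTranspose = X.conjTranspose := by
    have h₁ := congrArg Matrix.conjTranspose ((mem_corner_iff hV.isIdempotentElem).1 hX)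
    rw [Matrix.conjTranspose_mul, Matrix.conjTranspose_mul, starProjection_conjTranspose hV] at h₁
    nth_rewrite 1 [← h₁]
    rw [← mul_assoc, hV.isIdempotentElem.eq, h₁]
  have h₁ : W * X * W = 0 := by
    rw [← Matrix.trace_mul_conjTranspose_self_eq_zero_iff]
    have h₂ := h (W * X * W) ⟨X, rfl⟩
    have e : (W * X * W * (W * X * W).conjTranspose).trace
        = (X * (W * X * W).conjTranspose).trace := by
      rw [mul_assoc W, mul_assoc W, Matrix.trace_mul_comm]
      simp only [Matrix.conjTranspose_mul, hWc, mul_assoc, hW.isIdempotentElem.eq]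
      rw [← mul_assoc W W, hW.isIdempotentElem.eq]
    rw [e, h₂]
  have h₂ : X * W = 0 := hVW _ (by rw [← mul_assoc, hVX]) (by rw [← mul_assoc, h₁])
  have h₃ : W * X.conjTranspose = 0 := by
    have := congrArg Matrix.conjTranspose h₂
    rwa [Matrix.conjTranspose_mul, hWc, Matrix.conjTranspose_zero] at this
  exact Matrix.conjTranspose_eq_zero.1 (hVW _ hVX' h₃)

theorem mul_eq_zero_imp {V W : Mat k} (hd : matKer W ⊓ matIm V = ⊥) (Z : Mat k)
    (h₁ : V * Z = Z) (h₂ : W * Z = 0) : Z = 0 := by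
  rw [← matIm_eq_bot_iff, ← le_bot_iff, ← hd]
  refine le_inf (matIm_le_matKer_iff.2 h₂) ?_
  rw [← h₁]
  exact matIm_mul_le _ _

/-- Equal ranks and injectivity of `W` on `Im V` give `W V` the same image as `W`, so no nonzero
vector of `Im W` is orthogonal to `Im V`. -/
theorem mul_eq_zero_imp_symm {V W : Mat k} (hV : IsStarProjection V) (hW : IsStarProjection W)
    (hr : W.rank = V.rank) (hd : matKer W ⊓ matIm V = ⊥) (Z : Mat k)
    (h₁ : W * Z = Z) (h₂ : V * Z = 0) : Z = 0 := by
  have hker : matKer (W * V) = matKer V := by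
    ext x
    rw [mem_matKer, mem_matKer, ← Matrix.mulVec_mulVec]
    constructor
    · intro hx
      exact (Submodule.eq_bot_iff _).1 hd _ ⟨mem_matKer.2 hx, ⟨x, rfl⟩⟩
    · intro hx
      rw [hx, Matrix.mulVec_zero]
  have hfin : Module.finrank ℂ (matIm (W * V)) = Module.finrank ℂ (matIm W) := by
    have e₁ := finrank_matIm_add_matKer (W * V)
    have e₂ := finrank_matIm_add_matKer V
    rw [hker] at e₁
    have e₃ : Module.finrank ℂ (matIm W) = Module.finrank ℂ (matIm V) := hr
    omega
  obtain ⟨C, hC⟩ := exists_mul_eq_of_matIm_le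
    (Submodule.eq_of_le_of_finrank_eq (matIm_mul_le W V) hfin).ge
  have h₁' := congrArg Matrix.conjTranspose h₁
  have h₂' := congrArg Matrix.conjTranspose h₂
  rw [Matrix.conjTranspose_mul, starProjection_conjTranspose hW] at h₁'
  rw [Matrix.conjTranspose_mul, starProjection_conjTranspose hV, Matrix.conjTranspose_zero] at h₂'
  rw [← Matrix.conjTranspose_eq_zero, ← h₁', hC, ← mul_assoc, ← mul_assoc, h₁', h₂', zero_mul]

/-- If one restriction had no such eigenvalue, subtracting the scalar would make it surjective,
while its range is orthogonal to the eigenvectors of the other. Nondegeneracy of the pairing would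
kill those eigenvectors. -/
theorem hasEigenvalue_traceAdjoint_iff {V W : Mat k} (hV : IsStarProjection V)
    (hW : IsStarProjection W) (hr : W.rank = V.rank) (hd : matKer W ⊓ matIm V = ⊥)
    (hTV : LeavesCornerInvariant T V) (hTW : LeavesCornerInvariant (traceAdjoint T) W) (μ : ℂ) :
    Module.End.HasEigenvalue ((traceAdjoint T).restrict hTW) (star μ) ↔
      Module.End.HasEigenvalue (T.restrict hTV) μ := by
  constructor
  · intro h
    obtain ⟨⟨Y, hY⟩, hY₁, hY₂⟩ := h.exists_hasEigenvector
    rw [Module.End.mem_eigenspace_iff] at hY₁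
    have hY₃ : traceAdjoint T Y = star μ • Y := congrArg Subtype.val hY₁
    by_contra hc
    refine hY₂ (Subtype.ext ?_)
    refine eq_zero_of_trace_corner hW hV (mul_eq_zero_imp_symm hV hW hr hd) hY fun X hX => ?_
    obtain ⟨⟨Z, hZ⟩, hZX⟩ := exists_sub_smul_eq_of_not_hasEigenvalue hc ⟨X, hX⟩
    have hZX' : T Z - μ • Z = X := congrArg Subtype.val hZX
    have e : (Y * X.conjTranspose).trace = star (X * Y.conjTranspose).trace := by
      rw [← Matrix.trace_conjTranspose, Matrix.conjTranspose_mul,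
        Matrix.conjTranspose_conjTranspose]
    change (Y * X.conjTranspose).trace = 0
    rw [e, ← hZX', sub_mul, Matrix.trace_sub, trace_mul_traceAdjoint, hY₃,
      Matrix.conjTranspose_smul, star_star, Matrix.mul_smul, Matrix.smul_mul, sub_self, star_zero]
  · intro h
    obtain ⟨⟨X, hX⟩, hX₁, hX₂⟩ := h.exists_hasEigenvector
    rw [Module.End.mem_eigenspace_iff] at hX₁
    have hX₃ : T X = μ • X := congrArg Subtype.val hX₁
    by_contra hc
    refine hX₂ (Subtype.ext ?_)
    refine eq_zero_of_trace_corner hV hW (mul_eq_zero_imp hd) hX fun Y hY => ?_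
    obtain ⟨⟨Z, hZ⟩, hZY⟩ := exists_sub_smul_eq_of_not_hasEigenvalue hc ⟨Y, hY⟩
    have hZY' : traceAdjoint T Z - star μ • Z = Y := congrArg Subtype.val hZY
    rw [← hZY', Matrix.conjTranspose_sub, mul_sub, Matrix.trace_sub, ← trace_mul_traceAdjoint, hX₃,
      Matrix.conjTranspose_smul, star_star, Matrix.mul_smul, Matrix.smul_mul, sub_self]

theorem isSpectralRadius_traceAdjoint {V W : Mat k} (hV : IsStarProjection V)
    (hW : IsStarProjection W) (hr : W.rank = V.rank) (hd : matKer W ⊓ matIm V = ⊥)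
    (hTV : LeavesCornerInvariant T V) (hTW : LeavesCornerInvariant (traceAdjoint T) W) {lam : ℝ}
    (h : IsSpectralRadius (T.restrict hTV) lam) :
    IsSpectralRadius ((traceAdjoint T).restrict hTW) lam := by
  have key := hasEigenvalue_traceAdjoint_iff hV hW hr hd hTV hTW
  rw [IsSpectralRadius] at h ⊢
  convert h using 2
  ext r
  constructor
  · rintro ⟨μ, hμ, rfl⟩
    exact ⟨star μ, (key _).1 (by rwa [star_star]), (norm_star μ).symm⟩
  · rintro ⟨μ, hμ, rfl⟩
    exact ⟨star μ, (key _).2 hμ, (norm_star μ).symm⟩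

theorem exists_isSpectralRadius {V : Mat k} (hV : IsStarProjection V) (h₀ : V ≠ 0)
    (L : corner V →ₗ[ℂ] corner V) : ∃ lam, IsSpectralRadius L lam := by
  have hVc : V ∈ corner V := ⟨1, by rw [mul_one, hV.isIdempotentElem.eq]⟩
  have : Nontrivial (corner V) := ⟨⟨V, hVc⟩, 0, fun h => h₀ (congrArg Subtype.val h)⟩
  obtain ⟨μ, hμ⟩ := Module.End.exists_eigenvalue L
  obtain ⟨ν, hν, hmax⟩ := Set.exists_max_image {μ : ℂ | Module.End.HasEigenvalue L μ} norm
    (Module.End.finite_hasEigenvalue L) ⟨μ, hμ⟩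
  refine ⟨‖ν‖, ⟨ν, hν, rfl⟩, ?_⟩
  rintro _ ⟨μ, hμ, rfl⟩
  exact hmax μ hμ

end Spectrum

theorem existsUnique_of_isBlockSystem (hT : IsPositiveMap T)
    (hsupp : ∀ X : Mat k, X.PosSemidef → matIm X ≤ matIm (T X)) {s : ℕ} {p : Fin s → Mat k}
    (h : IsBlockSystem T p) (hp : ∀ i, IsMinimalPreserved T (matIm (p i))) {V : Mat k} {lam : ℝ}
    (hV : IsStarProjection V) (hTV : IsIrreducibleOnWithRadius T V lam) :
    ∃! W : Mat k, IsStarProjection W ∧ IsIrreducibleOnWithRadius (traceAdjoint T) W lam ∧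
      W.rank = V.rank ∧ matKer W ⊓ matIm V = ⊥ := by
  obtain ⟨hleave, hirr, hrad⟩ := hTV
  obtain ⟨i, hi⟩ := h.eq_matIm hT hsupp hp
    ((isIrreducibleOn_iff_isMinimalPreserved hT hsupp hV).1 ⟨hleave, hirr⟩)
  obtain ⟨Q, hQ, hQp⟩ := exists_starProjection (matKer (p i))
  have hW := hQ.one_sub
  have hWp : matKer (1 - Q) = matKer (p i) := by
    rw [matKer_eq_matIm_one_sub hW.isIdempotentElem, sub_sub_cancel, hQp]
  have hrank : ∀ W : Mat k, W.rank = V.rank ↔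
      Module.finrank ℂ (matKer W) = Module.finrank ℂ (matKer (p i)) := by
    intro W
    have e₁ := finrank_matIm_add_matKer W
    have e₂ := finrank_matIm_add_matKer (p i)
    change Module.finrank ℂ (matIm W) = Module.finrank ℂ (matIm V) ↔ _
    rw [hi]
    omega
  have hd : matKer (1 - Q) ⊓ matIm V = ⊥ := by
    rw [hWp, hi, eq_bot_iff]
    rintro _ ⟨h₁, ⟨x, rfl⟩⟩
    rw [SetLike.mem_coe, mem_matKer, Matrix.mulVecLin_apply, Matrix.mulVec_mulVec,
      h.mul_self] at h₁
    exact h₁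
  have hr := (hrank (1 - Q)).2 (by rw [hWp])
  refine ⟨1 - Q, ⟨hW, ?_, hr, hd⟩, ?_⟩
  · obtain ⟨hl, hirr'⟩ := h.isIrreducibleOn_traceAdjoint hT hsupp hp hW hWp
    exact ⟨hl, hirr', isSpectralRadius_traceAdjoint hV hW hr hd hleave hl hrad⟩
  -- `ker W'` is preserved by `T` and meets `Im (p i)` trivially, hence lies in `ker (p i)`; the
  -- rank condition makes them equal.
  · rintro W' ⟨hW', ⟨hl, -, -⟩, hr', hd'⟩
    have h₁ := (leavesCornerInvariant_iff (isPositiveMap_traceAdjoint hT) hW').1 hl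
    rw [preservesImage_traceAdjoint_iff hT hW',
      ← matKer_eq_matIm_one_sub hW'.isIdempotentElem] at h₁
    rw [hi] at hd'
    have h₂ := Submodule.eq_of_le_of_finrank_eq (h.le_matKer hT hsupp h₁ hd') ((hrank W').1 hr')
    rw [matKer_eq_matIm_one_sub hW'.isIdempotentElem, ← hQp] at h₂
    rw [← starProjection_ext hW'.one_sub hQ h₂, sub_sub_cancel]

theorem exists_isCompl_of_existsUnique (hT : IsPositiveMap T)
    (hsupp : ∀ X : Mat k, X.PosSemidef → matIm X ≤ matIm (T X))
    (h : ∀ (V : Mat k) (lam : ℝ), IsStarProjection V → IsIrreducibleOnWithRadius T V lam →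
      ∃! W : Mat k, IsStarProjection W ∧ IsIrreducibleOnWithRadius (traceAdjoint T) W lam ∧
        W.rank = V.rank ∧ matKer W ⊓ matIm V = ⊥)
    {U : Submodule ℂ (Fin k → ℂ)} (hU : IsMinimalPreserved T U) :
    ∃ U', PreservesImage T U' ∧ IsCompl U U' := by
  obtain ⟨V, hV, rfl⟩ := exists_starProjection U
  obtain ⟨hl, hirr⟩ := (isIrreducibleOn_iff_isMinimalPreserved hT hsupp hV).2 hU
  obtain ⟨lam, hlam⟩ := exists_isSpectralRadius hV (fun h₀ => hU.2.1 (matIm_eq_bot_iff.2 h₀))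
    (T.restrict hl)
  obtain ⟨W, ⟨hW, ⟨hl', -, -⟩, hr, hd⟩, -⟩ := h V lam hV ⟨hl, hirr, hlam⟩
  have h₁ := (leavesCornerInvariant_iff (isPositiveMap_traceAdjoint hT) hW).1 hl'
  rw [preservesImage_traceAdjoint_iff hT hW, ← matKer_eq_matIm_one_sub hW.isIdempotentElem] at h₁
  have hd' : Disjoint (matIm V) (matKer W) := by
    rw [disjoint_iff, inf_comm, hd]
  refine ⟨matKer W, h₁, hd', codisjoint_iff.2 ?_⟩
  refine Submodule.eq_top_of_disjoint _ _ ?_ hd'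
  have e₁ := finrank_matIm_add_matKer W
  have e₂ : Module.finrank ℂ (matIm W) = Module.finrank ℂ (matIm V) := hr
  rw [Module.finrank_fin_fun]
  omega

end Mat

/-! ### Compactness, determinant derivatives and normalized block diagonal matrices. -/

namespace Mat

open Filter Topology

variable {k : ℕ} {T : Mat k →ₗ[ℂ] Mat k}

section Topology

theorem isClosed_posSemidef : IsClosed {X : Mat k | X.PosSemidef} := by
  simp only [Matrix.posSemidef_iff_dotProduct_mulVec, Set.ofPred_and, Set.ofPred_forall]
  refine IsClosed.inter ?_ (isClosed_iInter fun x => ?_)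
  · exact isClosed_eq (Continuous.matrix_conjTranspose continuous_id) continuous_id
  · refine isClosed_le continuous_const ?_
    exact Continuous.dotProduct continuous_const
      (Continuous.matrix_mulVec continuous_id continuous_const)

theorem isCompact_entries_le (c : ℝ) : IsCompact {X : Mat k | ∀ i j, ‖X i j‖ ≤ c} := by
  have e : {X : Mat k | ∀ i j, ‖X i j‖ ≤ c} =
      Set.univ.pi fun _ : Fin k => Set.univ.pi fun _ : Fin k => Metric.closedBall (0 : ℂ) c :=
    Set.ext fun X => ⟨fun h i _ j _ => by simpa using h i j,
      fun h i j => by simpa using h i trivial j trivial⟩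
  rw [e]
  exact isCompact_univ_pi fun _ => isCompact_univ_pi fun _ => isCompact_closedBall (0 : ℂ) c

/-- A single ultrafilter serves all bounded sequences at once, which avoids successive subsequences.
-/
theorem exists_tendsto_of_bounded (u : Ultrafilter ℕ) (Z : ℕ → Mat k) (c : ℝ)
    (h : ∀ n i j, ‖Z n i j‖ ≤ c) : ∃ Z₀, Tendsto Z u (𝓝 Z₀) := by
  obtain ⟨Z₀, -, hZ₀⟩ := (isCompact_entries_le (k := k) c).ultrafilter_le_nhds (u.map Z)
    (by
      rw [le_principal_iff]
      exact Filter.mem_map.2 (Filter.univ_mem' fun n => h n))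
  exact ⟨Z₀, hZ₀⟩

theorem trace_mul_self_re {R : Mat k} (hR : R.IsHermitian) :
    (R * R).trace.re = ∑ i, ∑ j, ‖R i j‖ ^ 2 := by
  have : (R * R).trace = ∑ i, ∑ j, ((‖R i j‖ ^ 2 : ℝ) : ℂ) := by
    nth_rewrite 2 [← hR.eq]
    simp only [Matrix.trace, Matrix.diag, Matrix.mul_apply, Matrix.conjTranspose_apply]
    refine Finset.sum_congr rfl fun i _ => Finset.sum_congr rfl fun j _ => ?_
    rw [Complex.star_def, Complex.mul_conj, Complex.normSq_eq_norm_sq]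
  rw [this]
  exact_mod_cast rfl

theorem norm_apply_sq_le {R : Mat k} (hR : R.IsHermitian) (i j : Fin k) :
    ‖R i j‖ ^ 2 ≤ (R * R).trace.re := by
  rw [trace_mul_self_re hR]
  refine le_trans ?_ (Finset.single_le_sum (f := fun i => ∑ j, ‖R i j‖ ^ 2)
    (fun i _ => Finset.sum_nonneg fun j _ => sq_nonneg _) (Finset.mem_univ i))
  exact Finset.single_le_sum (f := fun j => ‖R i j‖ ^ 2) (fun j _ => sq_nonneg _)
    (Finset.mem_univ j)

theorem norm_apply_le_trace_add_one {R : Mat k} (hR : R.IsHermitian) (i j : Fin k) :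
    ‖R i j‖ ≤ (R * R).trace.re + 1 := by
  nlinarith [norm_apply_sq_le hR i j, sq_nonneg (‖R i j‖ - 1)]

theorem norm_apply_le_trace {X : Mat k} (hX : X.PosSemidef) (i j : Fin k) :
    ‖X i j‖ ≤ X.trace.re := by
  obtain ⟨R, hR, rfl⟩ := exists_posSemidef_sqrt hX
  have hrow : ∀ a, ∑ l, ‖R a l‖ ^ 2 ≤ (R * R).trace.re := by
    intro a
    rw [trace_mul_self_re hR.isHermitian]
    exact Finset.single_le_sum (f := fun i => ∑ j, ‖R i j‖ ^ 2)
      (fun i _ => Finset.sum_nonneg fun j _ => sq_nonneg _) (Finset.mem_univ a)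
  have hsymm : ∀ l, ‖R l j‖ = ‖R j l‖ := by
    intro l
    rw [← hR.isHermitian.apply l j, norm_star]
  have h₁ : ‖(R * R) i j‖ ≤ ∑ l, (‖R i l‖ ^ 2 + ‖R j l‖ ^ 2) / 2 := by
    rw [Matrix.mul_apply]
    refine (norm_sum_le _ _).trans (Finset.sum_le_sum fun l _ => ?_)
    rw [norm_mul, hsymm]
    nlinarith [sq_nonneg (‖R i l‖ - ‖R j l‖)]
  rw [← Finset.sum_div, Finset.sum_add_distrib] at h₁
  linarith [hrow i, hrow j]

theorem tendsto_matrix_inv {ι : Type*} {l : Filter ι} {Z : ι → Mat k} {Z₀ : Mat k}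
    (h : Tendsto Z l (𝓝 Z₀)) (h₀ : IsUnit Z₀) :
    Tendsto (fun n => (Z n)⁻¹) l (𝓝 Z₀⁻¹) := by
  have hdet : Z₀.det ≠ 0 := ((Matrix.isUnit_iff_isUnit_det Z₀).1 h₀).ne_zero
  simp only [Matrix.inv_def, Ring.inverse_eq_inv']
  have h₁ : Tendsto (fun n => (Z n).det) l (𝓝 Z₀.det) :=
    ((Continuous.matrix_det continuous_id).tendsto Z₀).comp h
  have h₂ : Tendsto (fun n => (Z n).adjugate) l (𝓝 Z₀.adjugate) :=
    ((Continuous.matrix_adjugate continuous_id).tendsto Z₀).comp h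
  exact (h₁.inv₀ hdet).smul h₂

theorem continuous_map (T : Mat k →ₗ[ℂ] Mat k) : Continuous T :=
  LinearMap.continuous_of_finiteDimensional T

end Topology

section Derivative

theorem hasDerivAt_det_one_add_smul (M : Mat k) :
    HasDerivAt (fun t : ℝ => ((1 + (t : ℂ) • M).det).re) M.trace.re 0 := by
  have h₁ : ∀ z : ℂ, (1 + z • M).det =
      ((1 + (Polynomial.X : Polynomial ℂ) • M.map Polynomial.C).det).eval z := by
    intro z
    rw [← Polynomial.coe_evalRingHom, RingHom.map_det]
    congr 1
    ext i j
    by_cases hij : i = j <;> simp [hij] <;> ring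
  have h₂ := Polynomial.hasDerivAt
    ((1 + (Polynomial.X : Polynomial ℂ) • M.map Polynomial.C).det) (0 : ℂ)
  rw [Matrix.derivative_det_one_add_X_smul] at h₂
  have h₃ : HasDerivAt (fun z : ℂ => (1 + z • M).det) M.trace ((0 : ℝ) : ℂ) := by
    simpa only [h₁, Complex.ofReal_zero] using h₂
  exact h₃.real_of_complex

theorem re_trace_eq_of_isLocalMax {M N : Mat k}
    (h : IsLocalMax (fun t : ℝ => ((1 + (t : ℂ) • M).det).re - ((1 + (t : ℂ) • N).det).re) 0) :
    M.trace.re = N.trace.re :=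
  sub_eq_zero.1 (h.hasDerivAt_eq_zero
    ((hasDerivAt_det_one_add_smul M).sub (hasDerivAt_det_one_add_smul N)))

end Derivative

section Perturbation

theorem isUnit_of_matIm_eq_top {X : Mat k} (h : ⊤ ≤ matIm X) : IsUnit X := by
  rw [← Matrix.mulVec_surjective_iff_isUnit]
  intro y
  exact h (Submodule.mem_top (x := y))

theorem matIm_eq_top_of_isUnit {X : Mat k} (h : IsUnit X) : matIm X = ⊤ :=
  LinearMap.range_eq_top.2 (Matrix.mulVec_surjective_iff_isUnit.2 h)

theorem posDef_of_matIm {X : Mat k} (hX : X.PosSemidef) (h : ⊤ ≤ matIm X) : X.PosDef :=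
  hX.posDef_iff_isUnit.2 (isUnit_of_matIm_eq_top h)

theorem eventually_posSemidef_add_smul {X H : Mat k} (hX : X.PosDef) (hH : H.IsHermitian) :
    ∀ᶠ t : ℝ in 𝓝 0, (X + (t : ℂ) • H).PosSemidef := by
  obtain ⟨c, hc, h₁, h₂⟩ := exists_smul_one_sub H hH
  obtain ⟨d, hd, h₃⟩ := exists_smul_sub_posSemidef (X := 1) Matrix.PosSemidef.one hX.posSemidef
    (by rw [matIm_eq_top_of_isUnit hX.isUnit]; exact le_top)
  have hcd : 0 ≤ c * d := mul_nonneg hc hd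
  have hev : ∀ᶠ t : ℝ in 𝓝 0, |t| * (c * d) < 1 := by
    have : Tendsto (fun t : ℝ => |t| * (c * d)) (𝓝 0) (𝓝 (|0| * (c * d))) :=
      (continuous_abs.mul continuous_const).tendsto 0
    rw [abs_zero, zero_mul] at this
    exact this.eventually_lt_const one_pos
  filter_upwards [hev] with t ht
  -- `X + tH = (1 - |t|cd) X + |t|c (dX - 1) + (|t|c + tH)`
  have e : X + (t : ℂ) • H = ((1 - |t| * (c * d) : ℝ) : ℂ) • X +
      ((|t| * c : ℝ) : ℂ) • ((d : ℂ) • X - 1) +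
      (((|t| * c : ℝ) : ℂ) • (1 : Mat k) + (t : ℂ) • H) := by
    push_cast
    module
  rw [e]
  refine ((hX.posSemidef.smul ?_).add (h₃.smul ?_)).add ?_
  · exact_mod_cast (sub_nonneg.2 ht.le)
  · exact_mod_cast mul_nonneg (abs_nonneg t) hc
  · rcases le_total 0 t with h | h
    · have := h₂.smul (a := (t : ℂ)) (by exact_mod_cast h)
      convert this using 1
      rw [abs_of_nonneg h]
      push_cast
      module
    · have := h₁.smul (a := ((-t : ℝ) : ℂ)) (by exact_mod_cast neg_nonneg.2 h)
      convert this using 1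
      rw [abs_of_nonpos h]
      push_cast
      module

end Perturbation

section Blocks

variable {s : ℕ} {p : Fin s → Mat k}

/-- Block diagonal positive semidefinite matrices whose blocks have trace one. -/
def normalizedBlocks (p : Fin s → Mat k) : Set (Mat k) :=
  {X | X.PosSemidef ∧ ∀ i, p i * X = X * (p i).conjTranspose ∧ (p i * X).trace = 1}

theorem isCompact_normalizedBlocks (hp : ∑ i, p i = 1) : IsCompact (normalizedBlocks p) := by
  refine (isCompact_entries_le (s : ℝ)).of_isClosed_subset ?_ ?_
  · have e : normalizedBlocks p = {X | X.PosSemidef} ∩ ⋂ i,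
        ({X | p i * X = X * (p i).conjTranspose} ∩ {X | (p i * X).trace = 1}) := by
      ext X
      simp [normalizedBlocks]
    rw [e]
    refine isClosed_posSemidef.inter (isClosed_iInter fun i => IsClosed.inter ?_ ?_)
    · exact isClosed_eq (continuous_const.matrix_mul continuous_id)
        (continuous_id.matrix_mul continuous_const)
    · exact isClosed_eq (continuous_const.matrix_mul continuous_id).matrix_trace continuous_const
  · rintro X ⟨hX, h⟩ i j
    have htr : X.trace = s := by
      rw [← one_mul X, ← hp, Finset.sum_mul, Matrix.trace_sum,
        Finset.sum_congr rfl fun i _ => (h i).2]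
      simp
    simpa [htr] using norm_apply_le_trace hX i j

theorem posDef_of_blocks (hp : ∑ i, p i = 1) {X : Mat k} (hX : X.PosSemidef)
    (h : ∀ i, matIm (p i) ≤ matIm X) : X.PosDef := by
  refine posDef_of_matIm hX fun x _ => ?_
  have hx : x = ∑ i, (p i).mulVec x := by rw [← Matrix.sum_mulVec, hp, Matrix.one_mulVec]
  rw [hx]
  exact Submodule.sum_mem _ fun i _ => h i ⟨x, rfl⟩

theorem IsBlockSystem.mul_sum_smul (h : IsBlockSystem T p) (c : Fin s → ℂ) (i : Fin s) :
    p i * ∑ j, c j • (p j * (p j).conjTranspose) = c i • (p i * (p i).conjTranspose) := by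
  rw [Finset.mul_sum, Finset.sum_eq_single i _ (by simp)]
  · rw [Matrix.mul_smul, ← mul_assoc, h.mul_self]
  · intro j _ hj
    rw [Matrix.mul_smul, ← mul_assoc, h.mul_of_ne i j hj.symm, zero_mul, smul_zero]

theorem IsBlockSystem.sum_smul_mul (h : IsBlockSystem T p) (c : Fin s → ℂ) (i : Fin s) :
    (∑ j, c j • (p j * (p j).conjTranspose)) * (p i).conjTranspose =
      c i • (p i * (p i).conjTranspose) := by
  have := congrArg Matrix.conjTranspose (h.mul_sum_smul (fun j => star (c j)) i)
  simpa [Matrix.conjTranspose_mul, Matrix.conjTranspose_sum] using this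

theorem IsBlockSystem.posDef_sum_smul (h : IsBlockSystem T p) {c : Fin s → ℂ} (hc : ∀ i, 0 < c i) :
    (∑ j, c j • (p j * (p j).conjTranspose)).PosDef := by
  refine posDef_of_blocks h.sum_eq (Matrix.posSemidef_sum _ fun i _ =>
    (Matrix.posSemidef_self_mul_conjTranspose _).smul (hc i).le) fun i => ?_
  have h₁ := matIm_mul_le (∑ j, c j • (p j * (p j).conjTranspose))
    ((c i)⁻¹ • (p i).conjTranspose)
  rwa [Matrix.mul_smul, h.sum_smul_mul, smul_smul, inv_mul_cancel₀ (hc i).ne', one_smul,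
    matIm_self_mul_conjTranspose] at h₁

theorem IsBlockSystem.exists_posDef_mem (h : IsBlockSystem T p) (hp : ∀ i, p i ≠ 0) :
    ∃ X ∈ normalizedBlocks p, X.PosDef := by
  let c : Fin s → ℂ := fun i => (p i * (p i).conjTranspose).trace
  have hc₀ : ∀ i, c i ≠ 0 := fun i =>
    (Matrix.trace_mul_conjTranspose_self_eq_zero_iff).not.2 (hp i)
  have hc : ∀ i, 0 < (c i)⁻¹ := by
    intro i
    refine inv_pos.2 (lt_of_le_of_ne ?_ (hc₀ i).symm)
    exact (Matrix.posSemidef_self_mul_conjTranspose (p i)).trace_nonneg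
  have hpd := h.posDef_sum_smul hc
  refine ⟨_, ⟨hpd.posSemidef, fun i => ⟨?_, ?_⟩⟩, hpd⟩
  · rw [h.mul_sum_smul, h.sum_smul_mul]
  · rw [h.mul_sum_smul, Matrix.trace_smul, smul_eq_mul]
    exact inv_mul_cancel₀ (hc₀ i)

end Blocks

end Mat

/-! ### Critical points of the determinant quotient. -/

namespace Mat

open Filter Topology

variable {k : ℕ} {T : Mat k →ₗ[ℂ] Mat k} {s : ℕ} {p : Fin s → Mat k}

theorem trace_mul_im {X Y : Mat k} (hX : X.IsHermitian) (hY : Y.IsHermitian) :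
    (X * Y).trace.im = 0 := by
  rw [← Complex.conj_eq_iff_im, ← Complex.star_def, ← Matrix.trace_conjTranspose,
    Matrix.conjTranspose_mul, hX.eq, hY.eq, Matrix.trace_mul_comm]

theorem eq_zero_of_isHermitian (φ : Mat k →ₗ[ℂ] ℂ) (h : ∀ H : Mat k, H.IsHermitian → φ H = 0)
    (X : Mat k) : φ X = 0 := by
  have h₁ := h (X + X.conjTranspose) (by
    rw [Matrix.IsHermitian, Matrix.conjTranspose_add, Matrix.conjTranspose_conjTranspose, add_comm])
  have h₂ := h (Complex.I • (X - X.conjTranspose)) (by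
    rw [Matrix.IsHermitian, Matrix.conjTranspose_smul, Matrix.conjTranspose_sub,
      Matrix.conjTranspose_conjTranspose, ← neg_sub, smul_neg, ← neg_smul]
    simp)
  rw [map_add] at h₁
  rw [map_smul, map_sub, smul_eq_mul, mul_eq_zero] at h₂
  have h₃ := h₂.resolve_left Complex.I_ne_zero
  linear_combination (h₁ + h₃) / 2

/-- Factoring out `X` and `Φ X`, maximality along `X + t H` says that `det (1 + t X⁻¹ H) - det (1 +
t (Φ X)⁻¹ Φ H)` is at most its value 0 at `t = 0`, so its derivative there vanishes. -/
theorem trace_eq_of_isMaxOn {Φ : Mat k →ₗ[ℂ] Mat k}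
    (hΦ : IsPositiveMap Φ) (hpd : ∀ X ∈ normalizedBlocks p, (Φ X).PosDef) {X : Mat k}
    (hX : X ∈ normalizedBlocks p) (hXpd : X.PosDef)
    (hmax : IsMaxOn (fun X : Mat k => X.det.re / (Φ X).det.re) (normalizedBlocks p) X) {H : Mat k}
    (hH : H.IsHermitian)
    (hHp : ∀ i, p i * H = H * (p i).conjTranspose ∧ (p i * H).trace = 0) :
    (X⁻¹ * H).trace = ((Φ X)⁻¹ * Φ H).trace := by
  have hY := hpd X hX
  have hXu : IsUnit X.det := (Matrix.isUnit_iff_isUnit_det X).1 hXpd.isUnit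
  have hYu : IsUnit (Φ X).det := (Matrix.isUnit_iff_isUnit_det _).1 hY.isUnit
  have hXd := Complex.pos_iff.1 hXpd.det_pos
  have hYd := Complex.pos_iff.1 hY.det_pos
  refine Complex.ext (re_trace_eq_of_isLocalMax ?_) ?_
  · filter_upwards [eventually_posSemidef_add_smul hXpd hH] with t ht
    have hmem : X + (t : ℂ) • H ∈ normalizedBlocks p := by
      refine ⟨ht, fun i => ⟨?_, ?_⟩⟩
      · rw [mul_add, add_mul, Matrix.mul_smul, Matrix.smul_mul, (hX.2 i).1, (hHp i).1]
      · rw [mul_add, Matrix.mul_smul, Matrix.trace_add, Matrix.trace_smul, (hX.2 i).2, (hHp i).2,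
          smul_zero, add_zero]
    have e₁ : X + (t : ℂ) • H = X * (1 + (t : ℂ) • (X⁻¹ * H)) := by
      rw [mul_add, mul_one, Matrix.mul_smul, ← mul_assoc, Matrix.mul_nonsing_inv _ hXu, one_mul]
    have e₂ : Φ (X + (t : ℂ) • H) = Φ X * (1 + (t : ℂ) • ((Φ X)⁻¹ * Φ H)) := by
      rw [mul_add, mul_one, Matrix.mul_smul, ← mul_assoc, Matrix.mul_nonsing_inv _ hYu, one_mul,
        map_add, map_smul]
    have h₁ := Complex.pos_iff.1 (hpd _ hmem).det_pos
    have h₂ := isMaxOn_iff.1 hmax _ hmem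
    rw [e₂, Matrix.det_mul, Complex.mul_re, ← hYd.2, zero_mul, sub_zero] at h₁ h₂
    rw [e₁, Matrix.det_mul, Complex.mul_re, ← hXd.2, zero_mul, sub_zero] at h₂
    have h₃ := pos_of_mul_pos_right h₁.1 hYd.1.le
    rw [div_le_div_iff₀ h₁.1 hYd.1] at h₂
    have h₄ : (1 + (t : ℂ) • (X⁻¹ * H)).det.re ≤ (1 + (t : ℂ) • ((Φ X)⁻¹ * Φ H)).det.re := by
      refine le_of_mul_le_mul_left (a := X.det.re * (Φ X).det.re) ?_ (mul_pos hXd.1 hYd.1)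
      linarith
    simpa using h₄
  · rw [trace_mul_im hXpd.inv.isHermitian hH,
      trace_mul_im hY.inv.isHermitian (map_isHermitian hΦ hH)]

/-- The admissible variations, the block scalings `p i X` and the off-diagonal blocks together span
all matrices. -/
theorem IsBlockSystem.eq_zero_of_blocks {Φ : Mat k →ₗ[ℂ] Mat k} (h : IsBlockSystem Φ p) {X : Mat k}
    (hX : X ∈ normalizedBlocks p) (φ : Mat k →ₗ[ℂ] ℂ) (h₁ : ∀ i, φ (p i * X) = 0)
    (h₂ : ∀ i j, i ≠ j → ∀ H, φ (p i * H * (p j).conjTranspose) = 0)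
    (h₃ : ∀ H : Mat k, H.IsHermitian →
      (∀ i, p i * H = H * (p i).conjTranspose ∧ (p i * H).trace = 0) → φ H = 0) (H : Mat k) :
    φ H = 0 := by
  refine eq_zero_of_isHermitian φ (fun H hH => ?_) H
  have hpX : ∀ i j, p i * (p j * X) = if i = j then p i * X else 0 := by
    intro i j
    split_ifs with hij
    · rw [hij, ← mul_assoc, h.mul_self]
    · rw [← mul_assoc, h.mul_of_ne i j hij, zero_mul]
  let B : Fin s → Mat k := fun i => p i * H * (p i).conjTranspose
  have hB : ∀ i, (B i).IsHermitian := fun i => Matrix.isHermitian_mul_mul_conjTranspose (p i) hH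
  have hφH : φ H = ∑ i, φ (B i) := by
    have hX : H = ∑ i, ∑ j, p i * H * (p j).conjTranspose := by
      simp_rw [← Finset.mul_sum, ← Finset.sum_mul]
      rw [← Matrix.conjTranspose_sum, h.sum_eq]
      simp
    conv_lhs => rw [hX]
    simp_rw [map_sum]
    exact Finset.sum_congr rfl fun i _ =>
      Finset.sum_eq_single i (fun j _ hj => h₂ i j hj.symm H) (by simp)
  -- Since `p i X` has trace one, this makes each block traceless, so that their sum is an
  -- admissible variation.
  let D : Fin s → Mat k := fun i => B i - (B i).trace • (p i * X)
  have hpB : ∀ i, p i * B i = B i := fun i => by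
    simp only [B]
    rw [← mul_assoc, ← mul_assoc, h.mul_self]
  have hpD : ∀ i, p i * D i = D i := fun i => by
    simp only [D]
    rw [mul_sub, Matrix.mul_smul, hpX, if_pos rfl, hpB]
  have hpX' : ∀ i, (p i * X).IsHermitian := by
    intro i
    rw [Matrix.IsHermitian, Matrix.conjTranspose_mul, hX.1.isHermitian.eq, ← (hX.2 i).1]
  have hD : ∀ i, (D i).IsHermitian := by
    intro i
    refine (hB i).sub ?_
    rw [Matrix.IsHermitian, Matrix.conjTranspose_smul, (hpX' i).eq, ← Matrix.trace_conjTranspose,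
      (hB i).eq]
  have hpD' : ∀ i j, i ≠ j → p i * D j = 0 := by
    intro i j hij
    rw [← hpD, ← mul_assoc, h.mul_of_ne i j hij, zero_mul]
  have hpS : ∀ i, p i * ∑ j, D j = D i := by
    intro i
    rw [Finset.mul_sum, Finset.sum_eq_single i (fun j _ hj => hpD' i j hj.symm) (by simp), hpD]
  have hS : (∑ j, D j).IsHermitian := by
    rw [Matrix.IsHermitian, Matrix.conjTranspose_sum]
    exact Finset.sum_congr rfl fun i _ => hD i
  have h₄ := h₃ (∑ j, D j) hS fun i => by
    refine ⟨?_, ?_⟩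
    · have := congrArg Matrix.conjTranspose (hpS i)
      rw [Matrix.conjTranspose_mul, hS.eq, (hD i).eq] at this
      rw [hpS, this]
    · rw [hpS, Matrix.trace_sub, Matrix.trace_smul, (hX.2 i).2, smul_eq_mul, mul_one, sub_self]
  rw [map_sum] at h₄
  rw [hφH, ← h₄]
  refine Finset.sum_congr rfl fun i _ => ?_
  simp only [D]
  rw [map_sub, map_smul, h₁, smul_zero, sub_zero]

theorem IsBlockSystem.exists_stationary {Φ : Mat k →ₗ[ℂ] Mat k} (hΦ : IsPositiveMap Φ)
    (h : IsBlockSystem Φ p) (hp : ∀ i, p i ≠ 0)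
    (hpd : ∀ X ∈ normalizedBlocks p, (Φ X).PosDef) :
    ∃ X ∈ normalizedBlocks p, X.PosDef ∧ ∀ H, (Φ H * (Φ X)⁻¹).trace = (H * X⁻¹).trace := by
  obtain ⟨X₀, hX₀, hX₀pd⟩ := h.exists_posDef_mem hp
  have hcont : ContinuousOn (fun X : Mat k => X.det.re / (Φ X).det.re) (normalizedBlocks p) := by
    refine ContinuousOn.div ?_ ?_ fun X hX => (Complex.pos_iff.1 (hpd X hX).det_pos).1.ne'
    · exact (Complex.continuous_re.comp continuous_id.matrix_det).continuousOn
    · exact (Complex.continuous_re.comp (continuous_map Φ).matrix_det).continuousOn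
  obtain ⟨X, hX, hmax⟩ := (isCompact_normalizedBlocks h.sum_eq).exists_isMaxOn ⟨X₀, hX₀⟩ hcont
  have hY := hpd X hX
  have hXpd : X.PosDef := by
    rw [hX.1.posDef_iff_det_ne_zero]
    intro h₀
    have h₁ := isMaxOn_iff.1 hmax _ hX₀
    simp only [h₀, Complex.zero_re, zero_div] at h₁
    exact absurd h₁ (not_le.2 (div_pos (Complex.pos_iff.1 hX₀pd.det_pos).1
      (Complex.pos_iff.1 (hpd _ hX₀).det_pos).1))
  have hXu : IsUnit X.det := (Matrix.isUnit_iff_isUnit_det X).1 hXpd.isUnit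
  have hYu : IsUnit (Φ X).det := (Matrix.isUnit_iff_isUnit_det _).1 hY.isUnit
  refine ⟨X, hX, hXpd, fun H => ?_⟩
  let φ : Mat k →ₗ[ℂ] ℂ := Matrix.traceLinearMap (Fin k) ℂ ℂ ∘ₗ
    (LinearMap.mulRight ℂ (Φ X)⁻¹ ∘ₗ Φ - LinearMap.mulRight ℂ X⁻¹)
  have hφ : ∀ H, φ H = (Φ H * (Φ X)⁻¹).trace - (H * X⁻¹).trace := by
    intro H
    simp [φ]
  rw [← sub_eq_zero, ← hφ]
  refine h.eq_zero_of_blocks hX φ ?_ ?_ ?_ H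
  -- Scaling one block: `Φ (p i X) = p i (Φ X)`, so both traces equal `tr (p i)`.
  · intro i
    have e : Φ (p i * X) = p i * Φ X := by
      rw [h.mul_map, mul_assoc, ← (hX.2 i).1, ← mul_assoc, h.mul_self]
    rw [hφ, e, mul_assoc, Matrix.mul_nonsing_inv _ hYu, mul_assoc, Matrix.mul_nonsing_inv _ hXu,
      sub_self]
  -- Off-diagonal blocks: `Φ` kills them, and `(p j)ᴴ X⁻¹ = X⁻¹ p j` turns the other trace into one
  -- containing `p j p i = 0`.
  · intro i j hij H
    have e : X * ((p j).conjTranspose * X⁻¹) = X * (X⁻¹ * p j) := by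
      rw [← mul_assoc, ← mul_assoc, ← (hX.2 j).1, Matrix.mul_nonsing_inv _ hXu, one_mul,
        Matrix.mul_nonsing_inv_cancel_right _ _ hXu]
    have e' : (p j).conjTranspose * X⁻¹ = X⁻¹ * p j := hXpd.isUnit.mul_left_cancel e
    rw [hφ, h.map_of_ne i j hij, zero_mul, Matrix.trace_zero, mul_assoc, e', Matrix.trace_mul_comm,
      mul_assoc, ← mul_assoc (p j), h.mul_of_ne j i hij.symm, zero_mul, mul_zero,
      Matrix.trace_zero, sub_self]
  · intro H hH hHp
    rw [hφ, Matrix.trace_mul_comm, Matrix.trace_mul_comm H,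
      trace_eq_of_isMaxOn hΦ hpd hX hXpd hmax hH hHp, sub_self]

end Mat

/-! ### Perturbation, passage to the limit and scaling. -/

namespace Mat

open Filter Topology

variable {k : ℕ} {T : Mat k →ₗ[ℂ] Mat k} {s : ℕ} {p : Fin s → Mat k}

/-- The map `X ↦ ∑ i, tr(pᵢ X pᵢᴴ) pᵢ pᵢᴴ`. -/
def blockDepolarizing (p : Fin s → Mat k) : Mat k →ₗ[ℂ] Mat k :=
  ∑ i, (Matrix.traceLinearMap (Fin k) ℂ ℂ ∘ₗ LinearMap.mulLeft ℂ (p i) ∘ₗ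
    LinearMap.mulRight ℂ (p i).conjTranspose).smulRight (p i * (p i).conjTranspose)

theorem blockDepolarizing_apply (p : Fin s → Mat k) (X : Mat k) :
    blockDepolarizing p X =
      ∑ i, (p i * X * (p i).conjTranspose).trace • (p i * (p i).conjTranspose) := by
  simp [blockDepolarizing, LinearMap.sum_apply, mul_assoc]

theorem isPositiveMap_blockDepolarizing (p : Fin s → Mat k) :
    IsPositiveMap (blockDepolarizing p) := by
  intro X hX
  rw [blockDepolarizing_apply]
  exact Matrix.posSemidef_sum _ fun i _ => (Matrix.posSemidef_self_mul_conjTranspose _).smul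
    (hX.mul_mul_conjTranspose_same (p i)).trace_nonneg

theorem IsBlockSystem.trace_block (h : IsBlockSystem T p) (i j l : Fin s) (X : Mat k) :
    (p l * (p i * X * (p j).conjTranspose) * (p l).conjTranspose).trace =
      if l = i ∧ l = j then (p l * X * (p l).conjTranspose).trace else 0 := by
  have e : p l * (p i * X * (p j).conjTranspose) * (p l).conjTranspose =
      p l * p i * X * (p l * p j).conjTranspose := by
    rw [Matrix.conjTranspose_mul]
    simp only [mul_assoc]
  rw [e]
  split_ifs with hl
  · rw [← hl.1, ← hl.2, h.mul_self]
  · rw [not_and_or] at hl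
    rcases hl with hl | hl
    · rw [h.mul_of_ne l i hl, zero_mul, zero_mul, Matrix.trace_zero]
    · rw [h.mul_of_ne l j hl, Matrix.conjTranspose_zero, mul_zero, Matrix.trace_zero]

theorem IsBlockSystem.add_smul_blockDepolarizing (h : IsBlockSystem T p) (c : ℂ) :
    IsBlockSystem (T + c • blockDepolarizing p) p := by
  refine ⟨h.sum_eq, h.mul_self, h.mul_of_ne, fun i j hij X => ?_, fun i X => ?_⟩
  · rw [LinearMap.add_apply, h.map_of_ne i j hij, zero_add, LinearMap.smul_apply,
      blockDepolarizing_apply, Finset.sum_eq_zero, smul_zero]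
    intro l _
    rw [h.trace_block, if_neg (fun hl => hij (hl.1.symm.trans hl.2)), zero_smul]
  · rw [LinearMap.add_apply, LinearMap.add_apply, mul_add, h.mul_map, LinearMap.smul_apply,
      LinearMap.smul_apply, Matrix.mul_smul, blockDepolarizing_apply, blockDepolarizing_apply,
      h.mul_sum_smul, Finset.sum_eq_single i _ (by simp)]
    · rw [h.trace_block, if_pos ⟨rfl, rfl⟩]
    · intro j _ hj
      rw [h.trace_block, if_neg (fun hl => hj hl.1), zero_smul]

/-- The trace normalization makes the perturbing term constant on the compact set; its value is
positive definite, which keeps the perturbed denominator nonzero. -/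
theorem IsBlockSystem.blockDepolarizing_of_mem (h : IsBlockSystem T p) {X : Mat k}
    (hX : X ∈ normalizedBlocks p) :
    blockDepolarizing p X = ∑ i, (1 : ℂ) • (p i * (p i).conjTranspose) := by
  rw [blockDepolarizing_apply]
  refine Finset.sum_congr rfl fun i _ => ?_
  rw [mul_assoc, ← (hX.2 i).1, ← mul_assoc, h.mul_self, (hX.2 i).2]

theorem IsBlockSystem.posDef_add_smul (hT : IsPositiveMap T) (h : IsBlockSystem T p) {c : ℂ}
    (hc : 0 < c) {X : Mat k} (hX : X ∈ normalizedBlocks p) :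
    ((T + c • blockDepolarizing p) X).PosDef := by
  rw [LinearMap.add_apply, LinearMap.smul_apply, h.blockDepolarizing_of_mem hX]
  exact Matrix.PosDef.posSemidef_add (hT X hX.1) ((h.posDef_sum_smul fun _ => one_pos).smul hc)

/-- If `M ≤ 1` is annihilated by `S`, its trace is at most the dimension of the kernel of `S`. -/
theorem finrank_le_of_trace {M S Q : Mat k} (hM' : (1 - M).PosSemidef)
    (hSM : S * M = 0) (hQ : IsStarProjection Q) (htr : M.trace = Q.trace) :
    Module.finrank ℂ (matIm Q) ≤ Module.finrank ℂ (matKer S) := by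
  obtain ⟨F, hF, hFS⟩ := exists_starProjection (matKer S)
  have h₁ : F * M = M := by
    rw [← matIm_le_iff_mul_eq hF.isIdempotentElem, hFS, matIm_le_matKer_iff, hSM]
  have h₂ := trace_mul_nonneg (posSemidef_of_starProjection hF) hM'
  rw [mul_sub, mul_one, h₁, Matrix.trace_sub, htr, trace_starProjection hQ.isIdempotentElem,
    trace_starProjection hF.isIdempotentElem, hFS, sub_nonneg] at h₂
  exact_mod_cast h₂

/-- The rank bound and the support condition give `Im (T X) = Im X`, hence the same for each block
`p i X`. Its image is preserved and nonzero because its trace is one, so minimality makes it all of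
`Im (p i)`. -/
theorem IsBlockSystem.posDef_of_finrank_le (hT : IsPositiveMap T)
    (hsupp : ∀ X : Mat k, X.PosSemidef → matIm X ≤ matIm (T X)) (h : IsBlockSystem T p)
    (hp : ∀ i, IsMinimalPreserved T (matIm (p i))) {X : Mat k} (hX : X ∈ normalizedBlocks p)
    (hle : Module.finrank ℂ (matIm (T X)) ≤ Module.finrank ℂ (matIm X)) : X.PosDef := by
  have heq := Submodule.eq_of_le_of_finrank_le (hsupp X hX.1) hle
  refine posDef_of_blocks h.sum_eq hX.1 fun i => ?_
  have hXi := hX.1.mul_mul_conjTranspose_same (p i)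
  have e : p i * X * (p i).conjTranspose = p i * X := by
    rw [mul_assoc, ← (hX.2 i).1, ← mul_assoc, h.mul_self]
  have h₁ : matIm (T (p i * X * (p i).conjTranspose)) = matIm (p i * X * (p i).conjTranspose) := by
    rw [← h.mul_map, e, matIm_mul, matIm_mul, heq]
  have h₂ := preservesImage_matIm hT hXi h₁.le
  rw [e] at h₂
  rcases (hp i).2.2 _ (matIm_mul_le (p i) X) h₂ with h₃ | h₃
  · rw [matIm_eq_bot_iff] at h₃
    have h₄ := (hX.2 i).2
    rw [h₃, Matrix.trace_zero] at h₄
    exact absurd h₄ zero_ne_one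
  · rw [← h₃, (hX.2 i).1]
    exact matIm_mul_le _ _

/-- A normalized pair of matrices `(Φ X, X)` compresses `Φ` to a doubly stochastic map; its value
at a projection. -/
theorem exists_compression {Φ : Mat k →ₗ[ℂ] Mat k} (hΦ : IsPositiveMap Φ) {R S Q : Mat k}
    (hR : R.PosSemidef) (hS : S.PosSemidef) (hQ : IsStarProjection Q) (hRu : IsUnit R)
    (hSu : IsUnit S) (hSR : S * S = Φ (R * R))
    (hst : ∀ H, (Φ H * (S * S)⁻¹).trace = (H * (R * R)⁻¹).trace) :
    ∃ M : Mat k, M.PosSemidef ∧ (1 - M).PosSemidef ∧ M.trace = Q.trace ∧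
      S * M * S = Φ (R * Q * R) := by
  have hRd := (Matrix.isUnit_iff_isUnit_det R).1 hRu
  have hSd := (Matrix.isUnit_iff_isUnit_det S).1 hSu
  have hS' := hS.inv.isHermitian.eq
  have hconj : ∀ Z : Mat k, Z.PosSemidef → (S⁻¹ * Φ (R * Z * R) * S⁻¹).PosSemidef := by
    intro Z hZ
    have h₁ := hZ.mul_mul_conjTranspose_same R
    rw [hR.isHermitian.eq] at h₁
    have h₂ := (hΦ _ h₁).mul_mul_conjTranspose_same S⁻¹
    rwa [hS'] at h₂
  refine ⟨S⁻¹ * Φ (R * Q * R) * S⁻¹, hconj Q (posSemidef_of_starProjection hQ), ?_, ?_, ?_⟩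
  · have h₁ := hconj _ (posSemidef_of_starProjection hQ.one_sub)
    rw [mul_sub, sub_mul, mul_one, map_sub, mul_sub, sub_mul, ← hSR, ← mul_assoc,
      Matrix.nonsing_inv_mul _ hSd, one_mul, Matrix.mul_nonsing_inv _ hSd] at h₁
    exact h₁
  · rw [mul_assoc, Matrix.trace_mul_comm, mul_assoc, ← Matrix.mul_inv_rev, hst, Matrix.mul_inv_rev,
      ← mul_assoc, Matrix.mul_nonsing_inv_cancel_right _ _ hRd, Matrix.trace_mul_comm,
      ← mul_assoc, Matrix.nonsing_inv_mul _ hRd, one_mul]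
  · rw [← mul_assoc, ← mul_assoc, Matrix.mul_nonsing_inv _ hSd, one_mul, mul_assoc,
      Matrix.nonsing_inv_mul _ hSd, mul_one]

theorem isUnit_of_mul_self {R : Mat k} (h : IsUnit (R * R)) : IsUnit R := by
  rw [Matrix.isUnit_iff_isUnit_det, Matrix.det_mul] at h
  exact (Matrix.isUnit_iff_isUnit_det R).2 (isUnit_of_mul_isUnit_left h)

theorem IsBlockSystem.exists_fixedPoint (hT : IsPositiveMap T)
    (hsupp : ∀ X : Mat k, X.PosSemidef → matIm X ≤ matIm (T X)) (h : IsBlockSystem T p)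
    (hp : ∀ i, IsMinimalPreserved T (matIm (p i))) :
    ∃ X : Mat k, X.PosDef ∧ (T X).PosDef ∧ ∀ H, (T H * (T X)⁻¹).trace = (H * X⁻¹).trace := by
  let ε : ℕ → ℂ := fun n => ((1 / ((n : ℝ) + 1) : ℝ) : ℂ)
  have hε : ∀ n, 0 < ε n := fun n => by
    have : (0 : ℝ) < 1 / ((n : ℝ) + 1) := by positivity
    exact Complex.zero_lt_real.2 this
  let Φ : ℕ → Mat k →ₗ[ℂ] Mat k := fun n => T + ε n • blockDepolarizing p
  have hΦ : ∀ n, IsPositiveMap (Φ n) := fun n X hX =>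
    (hT X hX).add ((isPositiveMap_blockDepolarizing p X hX).smul (hε n).le)
  have hp₀ : ∀ i, p i ≠ 0 := fun i h₀ => (hp i).2.1 (matIm_eq_bot_iff.2 h₀)
  choose X hX hXpd hst using fun n => (h.add_smul_blockDepolarizing (ε n)).exists_stationary (hΦ n)
    hp₀ fun X hX => h.posDef_add_smul hT (hε n) hX
  have hY : ∀ n, (Φ n (X n)).PosDef := fun n => h.posDef_add_smul hT (hε n) (hX n)
  choose R hR hRX using fun n => exists_posSemidef_sqrt (hX n).1
  choose S hS hSY using fun n => exists_posSemidef_sqrt (hY n).posSemidef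
  let u : Ultrafilter ℕ := hyperfilter ℕ
  have hεu : Tendsto ε u (𝓝 0) := by
    have h₁ : Tendsto (fun n : ℕ => 1 / ((n : ℝ) + 1)) u (𝓝 0) :=
      tendsto_one_div_add_atTop_nhds_zero_nat.mono_left Nat.hyperfilter_le_atTop
    have h₂ := (Complex.continuous_ofReal.tendsto 0).comp h₁
    rwa [Complex.ofReal_zero] at h₂
  have hΦu : ∀ {Z : ℕ → Mat k} {Z₀ : Mat k}, Tendsto Z u (𝓝 Z₀) →
      Tendsto (fun n => Φ n (Z n)) u (𝓝 (T Z₀)) := by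
    intro Z Z₀ hZ
    have h₁ := ((continuous_map T).tendsto Z₀).comp hZ
    have h₂ := ((continuous_map (blockDepolarizing p)).tendsto Z₀).comp hZ
    have h₃ := h₁.add (hεu.smul h₂)
    rwa [zero_smul, add_zero] at h₃
  have hcomp := isCompact_normalizedBlocks (p := p) h.sum_eq
  -- limits of the square roots
  obtain ⟨C, hC⟩ := hcomp.exists_bound_of_continuousOn
    (f := fun X : Mat k => X.trace) continuous_id.matrix_trace.continuousOn
  obtain ⟨C', hC'⟩ := hcomp.exists_bound_of_continuousOn
    (f := fun X : Mat k => (T X).trace) (continuous_map T).matrix_trace.continuousOn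
  obtain ⟨C'', hC''⟩ := hcomp.exists_bound_of_continuousOn
    (f := fun X : Mat k => (blockDepolarizing p X).trace)
    (continuous_map (blockDepolarizing p)).matrix_trace.continuousOn
  have hYtr : ∀ n, (Φ n (X n)).trace.re ≤ C' + C'' := by
    intro n
    have h₁ : ‖ε n‖ ≤ 1 := by
      simp only [ε, Complex.norm_real, Real.norm_eq_abs]
      rw [abs_of_pos (by positivity), div_le_one (by positivity)]
      linarith [(Nat.cast_nonneg n : (0 : ℝ) ≤ n)]
    refine (Complex.re_le_norm _).trans ?_
    simp only [Φ, LinearMap.add_apply, LinearMap.smul_apply, Matrix.trace_add, Matrix.trace_smul,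
      smul_eq_mul]
    refine (norm_add_le _ _).trans (add_le_add (hC' _ (hX n)) ?_)
    rw [norm_mul]
    exact (mul_le_of_le_one_left (norm_nonneg _) h₁).trans (hC'' _ (hX n))
  obtain ⟨R₀, hR₀⟩ := exists_tendsto_of_bounded u R (C + 1) fun n i j => by
    have := norm_apply_le_trace_add_one (hR n).isHermitian i j
    rw [hRX] at this
    exact this.trans (add_le_add_left ((Complex.re_le_norm _).trans (hC _ (hX n))) 1)
  obtain ⟨S₀, hS₀⟩ := exists_tendsto_of_bounded u S (C' + C'' + 1) fun n i j => by
    have := norm_apply_le_trace_add_one (hS n).isHermitian i j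
    rw [hSY] at this
    exact this.trans (add_le_add_left (hYtr n) 1)
  have hR₀p : R₀.PosSemidef := isClosed_posSemidef.mem_of_tendsto hR₀ (Eventually.of_forall hR)
  have hS₀p : S₀.PosSemidef := isClosed_posSemidef.mem_of_tendsto hS₀ (Eventually.of_forall hS)
  have hXlim : Tendsto X u (𝓝 (R₀ * R₀)) := by
    simpa only [hRX] using hR₀.mul hR₀
  have hX₀ : R₀ * R₀ ∈ normalizedBlocks p :=
    hcomp.isClosed.mem_of_tendsto hXlim (Eventually.of_forall hX)
  have hYlim := hΦu hXlim
  have hSS : S₀ * S₀ = T (R₀ * R₀) := by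
    refine tendsto_nhds_unique ?_ hYlim
    simpa only [hSY] using hS₀.mul hS₀
  -- the rank comparison
  obtain ⟨Q, hQ, hQR⟩ := exists_starProjection (matKer R₀)
  have hRQ : R₀ * Q = 0 := matIm_le_matKer_iff.1 hQR.le
  -- Although the inverse of `S n` may blow up, `M n` stays between 0 and 1 with trace `dim ker R₀`,
  -- so it has a limit `M₀`.
  choose M hM hM' hMtr hMS using fun n => exists_compression (hΦ n) (hR n) (hS n) hQ
    (isUnit_of_mul_self (by rw [hRX]; exact (hXpd n).isUnit))
    (isUnit_of_mul_self (by rw [hSY]; exact (hY n).isUnit)) (by rw [hRX, hSY])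
    (by rw [hRX, hSY]; exact hst n)
  obtain ⟨M₀, hM₀⟩ := exists_tendsto_of_bounded u M Q.trace.re fun n i j => by
    have := norm_apply_le_trace (hM n) i j
    rwa [hMtr] at this
  have hM₀p : M₀.PosSemidef := isClosed_posSemidef.mem_of_tendsto hM₀ (Eventually.of_forall hM)
  have hM₀p' : (1 - M₀).PosSemidef :=
    isClosed_posSemidef.mem_of_tendsto (hM₀.const_sub 1) (Eventually.of_forall hM')
  have hM₀tr : M₀.trace = Q.trace := by
    refine tendsto_nhds_unique ((continuous_id.matrix_trace.tendsto M₀).comp hM₀) ?_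
    simp only [Function.comp_def, id, hMtr]
    exact tendsto_const_nhds
  have hSMS : S₀ * M₀ * S₀ = 0 := by
    have h₁ := hΦu ((hR₀.mul (tendsto_const_nhds (x := Q))).mul hR₀)
    rw [hRQ, zero_mul, map_zero] at h₁
    refine tendsto_nhds_unique ((hS₀.mul hM₀).mul hS₀) ?_
    simpa only [hMS] using h₁
  -- `S₀ M₀ = 0` with `M₀ ≤ 1` of trace `dim ker R₀` forces `dim ker R₀ ≤ dim ker S₀`, that is, `T
  -- (R₀ R₀)` has rank at most that of `R₀ R₀`.
  have hfin := finrank_le_of_trace hM₀p'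
    (mul_eq_zero_of_conj hM₀p (by rw [hS₀p.isHermitian.eq, hSMS])) hQ hM₀tr
  have hpd : (R₀ * R₀).PosDef := by
    refine h.posDef_of_finrank_le hT hsupp hp hX₀ ?_
    rw [← hSS, matIm_mul_self hR₀p, matIm_mul_self hS₀p]
    have e₁ := finrank_matIm_add_matKer R₀
    have e₂ := finrank_matIm_add_matKer S₀
    rw [hQR] at hfin
    omega
  have hpd' : (T (R₀ * R₀)).PosDef := by
    refine posDef_of_matIm (hT _ hpd.posSemidef) ?_
    rw [← matIm_eq_top_of_isUnit hpd.isUnit]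
    exact hsupp _ hpd.posSemidef
  refine ⟨_, hpd, hpd', fun H => ?_⟩
  have h₁ := (hΦu (tendsto_const_nhds (x := H))).mul (tendsto_matrix_inv hYlim hpd'.isUnit)
  have h₂ := (tendsto_const_nhds (x := H)).mul (tendsto_matrix_inv hXlim hpd.isUnit)
  refine tendsto_nhds_unique ((continuous_id.matrix_trace.tendsto _).comp h₁) ?_
  have h₃ := (continuous_id.matrix_trace.tendsto _).comp h₂
  refine h₃.congr fun n => ?_
  exact (hst n H).symm

/-- With `R² = X` and `S² = T X`, the map `Z ↦ S⁻¹ T (R Z R) S⁻¹` is unital by construction, and the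
critical point equation says exactly that it preserves the trace. -/
theorem exists_isDoublyStochastic_of_fixedPoint (hT : IsPositiveMap T) {X : Mat k}
    (hX : X.PosDef) (hTX : (T X).PosDef)
    (hst : ∀ H, (T H * (T X)⁻¹).trace = (H * X⁻¹).trace) :
    ∃ L : Mat k →ₗ[ℂ] Mat k, IsDoublyStochastic L ∧ MapEquivalent T L := by
  obtain ⟨R, hR, hRX⟩ := exists_posSemidef_sqrt hX.posSemidef
  obtain ⟨S, hS, hSX⟩ := exists_posSemidef_sqrt hTX.posSemidef
  have hRu : IsUnit R := isUnit_of_mul_self (by rw [hRX]; exact hX.isUnit)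
  have hSu : IsUnit S := isUnit_of_mul_self (by rw [hSX]; exact hTX.isUnit)
  have hRd := (Matrix.isUnit_iff_isUnit_det R).1 hRu
  have hSd := (Matrix.isUnit_iff_isUnit_det S).1 hSu
  have hRc := hR.isHermitian.eq
  have hSc := hS.inv.isHermitian.eq
  let L : Mat k →ₗ[ℂ] Mat k := LinearMap.mulLeft ℂ S⁻¹ ∘ₗ LinearMap.mulRight ℂ S⁻¹ ∘ₗ T ∘ₗ
    LinearMap.mulLeft ℂ R ∘ₗ LinearMap.mulRight ℂ R
  have hL : ∀ Z, L Z = S⁻¹ * T (R * Z * R) * S⁻¹ := fun Z => by simp [L, mul_assoc]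
  have hLp : IsPositiveMap L := by
    intro Z hZ
    have h₁ := hZ.mul_mul_conjTranspose_same R
    rw [hRc] at h₁
    have h₂ := (hT _ h₁).mul_mul_conjTranspose_same S⁻¹
    rwa [hSc, ← hL] at h₂
  refine ⟨L, ⟨hLp, ?_, ?_⟩, R, S⁻¹, hRu, ?_, fun Z => ?_⟩
  · rw [hL, mul_one, hRX, ← hSX, ← mul_assoc, Matrix.nonsing_inv_mul _ hSd, one_mul,
      Matrix.mul_nonsing_inv _ hSd]
  · have htr : ∀ Z, (L Z).trace = Z.trace := by
      intro Z
      rw [hL, mul_assoc, Matrix.trace_mul_comm, mul_assoc, ← Matrix.mul_inv_rev, hSX, hst, ← hRX,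
        Matrix.mul_inv_rev, ← mul_assoc, Matrix.mul_nonsing_inv_cancel_right _ _ hRd,
        Matrix.trace_mul_comm, ← mul_assoc, Matrix.nonsing_inv_mul _ hRd, one_mul]
    have h₁ : ∀ Z, (Z * (1 - traceAdjoint L 1).conjTranspose).trace = 0 := by
      intro Z
      rw [Matrix.conjTranspose_sub, mul_sub, Matrix.trace_sub, ← trace_mul_traceAdjoint]
      simp [htr]
    exact (sub_eq_zero.1 (Matrix.trace_mul_conjTranspose_self_eq_zero_iff.1 (h₁ _))).symm
  · rw [Matrix.isUnit_nonsing_inv_iff]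
    exact hSu
  · rw [hL, hRc, hSc]

end Mat

/-! ### The equivalence of the three statements. -/

theorem mainTheorem1 (k : ℕ) (A : BiMat k k) (hA : IsPPT A)
    (hT : ∀ X : Mat k, X.PosSemidef → matIm X ≤ matIm (mapGT A X)) :
    List.TFAE [
      ∃ L : Mat k →ₗ[ℂ] Mat k, IsDoublyStochastic L ∧ MapEquivalent (mapGT A) L,
      ∃ (s : ℕ) (V : Fin s → Mat k),
        (∀ i, IsStarProjection (V i)) ∧
        DirectSum.IsInternal (fun i => matIm (V i)) ∧
        ∀ i, IsIrreducibleOn (mapGT A) (V i),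
      ∀ (V : Mat k) (lam : ℝ), IsStarProjection V → IsIrreducibleOnWithRadius (mapGT A) V lam →
        ∃! W : Mat k, IsStarProjection W ∧
          IsIrreducibleOnWithRadius (traceAdjoint (mapGT A)) W lam ∧
          W.rank = V.rank ∧
          matKer W ⊓ matIm V = ⊥] := by
  have hpos := Mat.isPositiveMap_mapGT hA.1
  have blocks : (∃ (s : ℕ) (V : Fin s → Mat k), (∀ i, IsStarProjection (V i)) ∧
      DirectSum.IsInternal (fun i => matIm (V i)) ∧ ∀ i, IsIrreducibleOn (mapGT A) (V i)) →
      ∃ (s : ℕ) (p : Fin s → Mat k), Mat.IsBlockSystem (mapGT A) p ∧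
        ∀ i, Mat.IsMinimalPreserved (mapGT A) (matIm (p i)) := by
    rintro ⟨s, V, hV, hint, hirr⟩
    have hmin : ∀ i, Mat.IsMinimalPreserved (mapGT A) (matIm (V i)) := fun i =>
      (Mat.isIrreducibleOn_iff_isMinimalPreserved hpos hT (hV i)).1 (hirr i)
    obtain ⟨p, hp, hpV⟩ := Mat.exists_isBlockSystem hA hV hint fun i => (hmin i).1
    exact ⟨s, p, hp, fun i => by rw [hpV]; exact hmin i⟩
  tfae_have 1 → 2 := by
    rintro ⟨L, hL, hTL⟩
    exact Mat.exists_decomposition hpos hT fun U hU =>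
      Mat.exists_isCompl_of_mapEquivalent hpos hT hL hTL hU.1
  tfae_have 2 → 1 := by
    intro h
    obtain ⟨s, p, hp, hmin⟩ := blocks h
    obtain ⟨X, hX, hTX, hst⟩ := hp.exists_fixedPoint hpos hT hmin
    exact Mat.exists_isDoublyStochastic_of_fixedPoint hpos hX hTX hst
  tfae_have 2 → 3 := by
    intro h V lam hV hTV
    obtain ⟨s, p, hp, hmin⟩ := blocks h
    exact Mat.existsUnique_of_isBlockSystem hpos hT hp hmin hV hTV
  tfae_have 3 → 2 := fun h => Mat.exists_decomposition hpos hT fun U hU =>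
    Mat.exists_isCompl_of_existsUnique hpos hT h hU
  tfae_finish

end
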